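/- **Lemma 3.1.** Let $n\ge 2$ and write $x=(x_1,x')\in\mathbf R\times\mathbf R^{n-1}$, $\xi=(\xi_1,\xi')$. Use $\hat f(\xi)=\int_{\mathbf R^n} f(x)e^{-2\pi i x\cdot\xi}\,dx$, so that $e^{-it\Delta}$ is the Fourier multiplier operator with symbol $e^{4\pi^2 i t|\xi|^2}$. Let $\chi:[0,\infty)\to[0,\infty)$ be nonincreasing, smooth on $(0,\infty)$, equal to $1$ on $[0,1]$ and supported in $[0,2]$; put $\varphi(\xi)=\chi(|\xi|)-\chi(2|\xi|)$ and, for $k\in\mathbf Z$, let $P_k$ be the Littlewood–Paley projection $\widehat{P_kf}(\xi)=\varphi(2^{-k}\xi)\hat f(\xi)$. Write $f_k=P_kf$, and $F_k(t)=P_k(F(t,\cdot))$ for a function $F(t,x)$ of time and space. For an interval $\gamma\subseteq\mathbf R$ let $$\|u\|_{L^p_{x_1}L^2_{x'}L^2_\gamma}=\Big\|\Big(\int_{\mathbf R^{n-1}}\int_\gamma|u(t,x_1,x')|^2\,dt\,dx'\Big)^{1/2}\Big\|_{L^p_{x_1}(\mathbf R)},$$ and write $L^p_{x_1}L^2_{x',t}$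 when $\gamma=\mathbf R$. There exists a constant $C$ depending only on the dimension $n$ such that for all such $\chi$, all $k\in\mathbf Z$, and all Schwartz functions $f\in\mathcal S(\mathbf R^n)$, $F\in\mathcal S(\mathbf R\times\mathbf R^n)$ with $$\operatorname{supp}\hat f\subseteq\{|\xi'|\le\xi_1/10\},\qquad \operatorname{supp}_\xi\hat F(t,\cdot)\subseteq\{|\xi'|\le\xi_1/10\}\ \text{ for every } t\in\mathbf R$$ (where $\hat F(t,\cdot)$ is the Fourier transform in $x$ only), one has $$2^{k/2}\,\|e^{-it\Delta}f_k\|_{L^\infty_{x_1}L^2_{x'}L^2_\gamma}\le C\,\|f_k\|_{L^2(\mathbf R^n)}\quad\text{for every interval }\gamma\subseteq\mathbf R,$$ $$2^{k/2}\,\Big\|\int_{s<t}e^{-i(t-s)\Delta}F_k(s)\,ds\Big\|_{L^\infty_{x_1}L^2_{x',t}}\le C\,2^{-k/2}\,\|F_k\|_{L^1_{x_1}L^2_{x',t}},$$ and $$2^{k/2}\,\Big\|\int_\gamma e^{-it\Delta}F_k(t)\,dt\Big\|_{L^2(\mathbf R^n)}\le C\,\|F_k\|_{L^1_{x_1}L^2_{x'}L^2_\gamma}\quad\text{for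 every interval }\gamma\subseteq\mathbf R.$$ -/

import Mathlib

open MeasureTheory
open scoped ENNReal NNReal FourierTransform ContDiff

noncomputable section

namespace ConeSmoothing

/-- The space `ℝⁿ` with `n = d + 1` and its Euclidean structure. -/
abbrev Space (d : ℕ) : Type := EuclideanSpace ℝ (Fin (d + 1))

/-- The space of the transversal variable `x' = (x₂, …, xₙ)`. -/
abbrev Transversal (d : ℕ) : Type := EuclideanSpace ℝ (Fin d)

/-- The point `x = (x₁, x')` of `ℝⁿ`. -/
def point {d : ℕ} (x₁ : ℝ) (x' : Transversal d) : Space d :=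
  WithLp.toLp 2 (Fin.cons x₁ (fun i => x' i))

/-- The transversal part `ξ' = (ξ₂, …, ξₙ)` of `ξ`. -/
def transversal {d : ℕ} (ξ : Space d) : Transversal d :=
  WithLp.toLp 2 (fun i => ξ i.succ)

/-- The closed cone `|ξ'| ≤ ξ₁ / 10`. -/
def cone (d : ℕ) : Set (Space d) :=
  {ξ | ‖transversal ξ‖ ≤ ξ 0 / 10}

/-- The functions `χ : [0, ∞) → [0, ∞)` (only their values on the half-line are used) from which
Littlewood-Paley projections are built: nonincreasing, smooth away from `0`, equal to `1` on
`[0, 1]` and supported in `[0, 2]`. -/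
structure IsCutoff (χ : ℝ → ℝ) : Prop where
  nonneg : ∀ r, 0 ≤ r → 0 ≤ χ r
  antitone : AntitoneOn χ (Set.Ici 0)
  smooth : ContDiffOn ℝ ∞ χ (Set.Ioi 0)
  eq_one : ∀ r, 0 ≤ r → r ≤ 1 → χ r = 1
  eq_zero : ∀ r, 2 ≤ r → χ r = 0

/-- The radial function `φ(ξ) = χ(|ξ|) - χ(2|ξ|)`. -/
def annulus {d : ℕ} (χ : ℝ → ℝ) (ξ : Space d) : ℝ :=
  χ ‖ξ‖ - χ (2 * ‖ξ‖)

/-- The Fourier multiplier operator with symbol `m`, for the Fourier transform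
`∫ g(x) exp(-2πi x·ξ) dx`. -/
def multiplier {d : ℕ} (m : Space d → ℂ) (g : Space d → ℂ) : Space d → ℂ :=
  𝓕⁻ (fun ξ => m ξ * 𝓕 g ξ)

/-- The Littlewood-Paley projection `P_k`, with symbol `φ(2⁻ᵏ ξ)`. -/
def lpProj {d : ℕ} (χ : ℝ → ℝ) (k : ℤ) (g : Space d → ℂ) : Space d → ℂ :=
  multiplier (fun ξ => ((annulus χ ((2 : ℝ) ^ (-k) • ξ) : ℝ) : ℂ)) g

/-- The free propagator `exp(-itΔ)`. As `Δ` has the symbol `-4π²|ξ|²`, its symbol is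
`exp(4π² i t |ξ|²)`. -/
def propagator {d : ℕ} (t : ℝ) (g : Space d → ℂ) : Space d → ℂ :=
  multiplier (fun ξ => Complex.exp (4 * (Real.pi : ℂ) ^ 2 * Complex.I * (t : ℂ) *
    ((‖ξ‖ ^ 2 : ℝ) : ℂ))) g

/-- The time-dependent function `F_k(t) = P_k (F(t, ·))`. -/
def lpPiece {d : ℕ} (χ : ℝ → ℝ) (k : ℤ) (F : ℝ × Space d → ℂ) (t : ℝ) : Space d → ℂ :=
  lpProj χ k (fun x => F (t, x))

/-- The retarded Duhamel operator `∫_{s<t} exp(-i(t-s)Δ) G(s) ds`. -/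
def duhamel {d : ℕ} (G : ℝ → Space d → ℂ) (t : ℝ) (x : Space d) : ℂ :=
  ∫ s in Set.Iio t, propagator (t - s) (G s) x

/-- The function `∫_γ exp(-itΔ) G(t) dt`. -/
def timeIntegral {d : ℕ} (γ : Set ℝ) (G : ℝ → Space d → ℂ) (x : Space d) : ℂ :=
  ∫ t in γ, propagator t (G t) x

/-- The mixed norm `L^p_{x₁} L²_{x'} L²_t(γ)` of a function `u(t, x)`, with values in `[0, ∞]`. -/
def mixedNorm {d : ℕ} (p : ℝ≥0∞) (γ : Set ℝ) (u : ℝ → Space d → ℂ) : ℝ≥0∞ :=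
  eLpNorm (fun x₁ : ℝ =>
    eLpNorm (fun x' : Transversal d =>
      eLpNorm (fun t : ℝ => u t (point x₁ x')) 2 (volume.restrict γ)) 2 volume) p volume

end ConeSmoothing

end

/-! Write e(x) = exp(2πix) and m = 2^k, so that the propagator has symbol e(2πt|ξ|²). In the cone,
|ξ| ∼ m forces ξ₁ ∼ m, so ξ₁ ↦ 2πξ₁² is injective there with derivative ≳ m, and the frequency ξ₁
can be traded for a time frequency. Plancherel in x' reduces everything to one-dimensional estimates
for each fixed ξ', where the factor e(2πt|ξ'|²) is unimodular.

Homogeneous estimate: for fixed x₁ and ξ', this change of variables and Plancherel in t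
(`eLpNorm_extension_sq_le`) give the gain m^(-1/2). Dual estimate: Minkowski in y₁, then restriction
to the parabola (`lintegral_restriction_le`) for each y₁.

Retarded estimate: by `duhamelSlice_eq` the solution is an integral over y of time convolutions with
`kernel m (t - s) (x₁ - y)`. By Minkowski it suffices that the convolution truncated to s < t is
bounded on L² with norm O(1/m), uniformly in z = x₁ - y (`eLpNorm_retarded_kernel_convolution_le`).
Untruncated, it is an extension composed with a restriction. If z ≥ 0 and s < t, the phase has no
stationary point, and the kernel is dominated by a function with L¹ norm O(1/m), so Young's
inequality applies. If z ≤ 0 the same domination holds for s ≥ t, and the truncated operator is the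
full one minus that part.

Only the frequency support enters these bounds, and the kernel is built from one fixed `bump`; hence
the constant does not depend on χ. -/

noncomputable section

namespace ConeSmoothing

open Real Set

/-! ### Cauchy–Schwarz and Minkowski in L² -/

section L2

variable {α β : Type*} [MeasurableSpace α] [MeasurableSpace β] {μ : Measure α} {ν : Measure β}

theorem eLpNorm_two_sq {ε : Type*} [TopologicalSpace ε] [ContinuousENorm ε] (f : α → ε) :
    eLpNorm f 2 μ ^ 2 = ∫⁻ x, ‖f x‖ₑ ^ 2 ∂μ := by
  rw [eLpNorm_eq_lintegral_rpow_enorm_toReal (by norm_num) (by norm_num), ← ENNReal.rpow_natCast,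
    ← ENNReal.rpow_mul]
  norm_num

theorem le_of_sq_le_sq {a b : ℝ≥0∞} (h : a ^ 2 ≤ b ^ 2) : a ≤ b :=
  (ENNReal.pow_le_pow_left_iff two_ne_zero).1 h

theorem lintegral_mul_le_eLpNorm_two {f g : α → ℝ≥0∞} (hf : AEMeasurable f μ)
    (hg : AEMeasurable g μ) :
    ∫⁻ x, f x * g x ∂μ ≤ eLpNorm f 2 μ * eLpNorm g 2 μ := by
  have h := ENNReal.lintegral_mul_le_Lp_mul_Lq μ (p := 2) (q := 2) (by
    constructor <;> norm_num) hf hg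
  rw [eLpNorm_eq_lintegral_rpow_enorm_toReal (by norm_num) (by norm_num),
    eLpNorm_eq_lintegral_rpow_enorm_toReal (by norm_num) (by norm_num)]
  simpa using h

/-- Minkowski's integral inequality in `L²`. -/
theorem eLpNorm_two_lintegral_le [SFinite μ] [SFinite ν] {f : α → β → ℝ≥0∞}
    (hf : Measurable (Function.uncurry f)) :
    eLpNorm (fun x => ∫⁻ y, f x y ∂ν) 2 μ ≤ ∫⁻ y, eLpNorm (fun x => f x y) 2 μ ∂ν := by
  have hfx : ∀ x, Measurable (f x) := fun x => hf.comp measurable_prodMk_left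
  have hfy : ∀ y, Measurable (fun x => f x y) := fun y => hf.comp measurable_prodMk_right
  have hN : Measurable (fun y => eLpNorm (fun x => f x y) 2 μ) := by
    simp_rw [eLpNorm_eq_lintegral_rpow_enorm_toReal (p := 2) (by norm_num) (by norm_num)]
    refine Measurable.pow_const ?_ _
    have : Measurable (fun z : α × β => ‖f z.1 z.2‖ₑ ^ (2 : ℝ≥0∞).toReal) := by
      simp only [enorm_eq_self]
      exact hf.pow_const _
    exact this.lintegral_prod_left'
  have h3 : Measurable (fun z : (α × β) × β => f z.1.1 z.1.2 * f z.1.1 z.2) :=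
    (hf.comp measurable_fst).mul (hf.comp ((measurable_fst.comp measurable_fst).prodMk
      measurable_snd))
  have h3' : Measurable (fun z : (α × β) => ∫⁻ y', f z.1 z.2 * f z.1 y' ∂ν) :=
    h3.lintegral_prod_right'
  refine le_of_sq_le_sq ?_
  rw [eLpNorm_two_sq]
  calc ∫⁻ x, ‖∫⁻ y, f x y ∂ν‖ₑ ^ 2 ∂μ
      = ∫⁻ x, ∫⁻ y, ∫⁻ y', f x y * f x y' ∂ν ∂ν ∂μ := by
        refine lintegral_congr fun x => ?_
        rw [enorm_eq_self, sq, ← lintegral_mul_const _ (hfx x)]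
        exact lintegral_congr fun y => (lintegral_const_mul _ (hfx x)).symm
    _ = ∫⁻ y, ∫⁻ x, ∫⁻ y', f x y * f x y' ∂ν ∂μ ∂ν := lintegral_lintegral_swap h3'.aemeasurable
    _ = ∫⁻ y, ∫⁻ y', ∫⁻ x, f x y * f x y' ∂μ ∂ν ∂ν := by
        refine lintegral_congr fun y => lintegral_lintegral_swap ?_
        exact (h3.comp ((measurable_fst.prodMk measurable_const).prodMk
          measurable_snd)).aemeasurable
    _ ≤ ∫⁻ y, ∫⁻ y', eLpNorm (fun x => f x y) 2 μ * eLpNorm (fun x => f x y') 2 μ ∂ν ∂ν :=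
        lintegral_mono fun y => lintegral_mono fun y' =>
          lintegral_mul_le_eLpNorm_two (hfy y).aemeasurable (hfy y').aemeasurable
    _ = (∫⁻ y, eLpNorm (fun x => f x y) 2 μ ∂ν) ^ 2 := by
        simp_rw [lintegral_const_mul _ hN]
        rw [lintegral_mul_const _ hN, sq]

end L2

/-! ### Plancherel for the Fourier integral -/

section Plancherel

variable {V : Type*} [NormedAddCommGroup V] [InnerProductSpace ℝ V] [FiniteDimensional ℝ V]
  [MeasurableSpace V] [BorelSpace V]

theorem integral_fourier_mul_eq {f g : V → ℂ} (hf : Integrable f) (hg : Integrable g) :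
    ∫ ξ, 𝓕 f ξ * g ξ = ∫ x, f x * 𝓕 g x := by
  have := VectorFourier.integral_fourierIntegral_smul_eq_flip (μ := volume) (ν := volume)
    (L := innerₗ V) (f := f) (g := g) Real.continuous_fourierChar (by exact continuous_inner) hf hg
  rw [flip_innerₗ] at this
  exact this

theorem continuous_fourier {f : V → ℂ} (hf : Integrable f) : Continuous (𝓕 f) :=
  VectorFourier.fourierIntegral_continuous Real.continuous_fourierChar
    (by exact continuous_inner) hf

/-- Plancherel's theorem for integrable functions. -/
theorem eLpNorm_fourier_le {g : V → ℂ} (hg : Integrable g) :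
    eLpNorm (𝓕 g) 2 volume ≤ eLpNorm g 2 volume := by
  by_cases h2 : eLpNorm g 2 volume = ⊤
  · simp [h2]
  have hg2 : MemLp g 2 volume := ⟨hg.1, lt_top_iff_ne_top.2 h2⟩
  set T : Lp ℂ 2 (volume : Measure V) := 𝓕 (hg2.toLp g) with hT
  -- `T` is the abstract L² Fourier transform. Testing against smooth compactly supported functions
  -- and using the multiplication formula identifies it with the integral almost everywhere.
  have key : ∀ᵐ x, T x = 𝓕 g x := by
    apply ae_eq_of_integral_contDiff_smul_eq
    · exact (Lp.memLp T).locallyIntegrable (by norm_num)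
    · exact (continuous_fourier hg).locallyIntegrable
    intro φ hφ hφc
    have hs : HasCompactSupport (fun x => (φ x : ℂ)) := hφc.comp_left (g := ((↑) : ℝ → ℂ)) rfl
    have hs' : ContDiff ℝ ∞ (fun x => (φ x : ℂ)) := Complex.ofRealCLM.contDiff.comp hφ
    set Φ : SchwartzMap V ℂ := hs.toSchwartzMap hs' with hΦ
    have h1 := congrArg (fun D => D Φ) (Lp.fourier_toTemperedDistribution_eq (hg2.toLp g))
    simp only [TemperedDistribution.fourier_apply, Lp.toTemperedDistribution_apply] at h1
    have h3 : ∫ x, (𝓕 Φ) x • (hg2.toLp g) x = ∫ x, g x * 𝓕 (fun x => (φ x : ℂ)) x := by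
      apply integral_congr_ae
      filter_upwards [hg2.coeFn_toLp] with x hx
      rw [hx, smul_eq_mul, mul_comm, SchwartzMap.fourier_coe]
      rfl
    rw [h3] at h1
    have h4 := integral_fourier_mul_eq hg Φ.integrable
    have h5 : (Φ : V → ℂ) = fun x => (φ x : ℂ) := rfl
    rw [h5] at h4
    rw [← h4] at h1
    have e1 : ∫ x, φ x • T x = ∫ x, Φ x • T x := rfl
    rw [e1, ← h1]
    refine integral_congr_ae (.of_forall fun x => ?_)
    simp [mul_comm]
  rw [← eLpNorm_congr_ae key, ← eLpNorm_congr_ae hg2.coeFn_toLp]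
  have := Lp.norm_fourier_eq (hg2.toLp g)
  rw [← hT, Lp.norm_def, Lp.norm_def, ENNReal.toReal_eq_toReal_iff' (Lp.eLpNorm_ne_top _)
    (Lp.eLpNorm_ne_top _)] at this
  exact this.le

theorem eLpNorm_fourierInv_le {g : V → ℂ} (hg : Integrable g) :
    eLpNorm (𝓕⁻ g) 2 volume ≤ eLpNorm g 2 volume := by
  have h : 𝓕⁻ g = (𝓕 g) ∘ (fun x => -x) := by
    ext x; exact Real.fourierInv_eq_fourier_neg g x
  rw [h, eLpNorm_comp_measurePreserving (continuous_fourier hg).aestronglyMeasurable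
    (Measure.measurePreserving_neg volume)]
  exact eLpNorm_fourier_le hg

end Plancherel

/-! ### Restriction to and extension from the parabola -/

section Parabola

variable {l : ℝ}

theorem injOn_two_pi_mul_sq (hl : 0 < l) : InjOn (fun ξ : ℝ => 2 * π * ξ ^ 2) (Ici l) := by
  intro a ha b hb h
  have ha' : 0 ≤ a := hl.le.trans ha
  have hb' : 0 ≤ b := hl.le.trans hb
  have h' : a ^ 2 = b ^ 2 := mul_left_cancel₀ (by positivity : 2 * π ≠ 0) h
  exact (pow_left_inj₀ ha' hb' two_ne_zero).1 h'

theorem hasDerivAt_two_pi_mul_sq (ξ : ℝ) :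
    HasDerivAt (fun ξ : ℝ => 2 * π * ξ ^ 2) (4 * π * ξ) ξ := by
  refine (((hasDerivAt_id' ξ).pow 2).const_mul (2 * π)).congr_deriv ?_
  norm_num
  ring

/-- Substitute η = 2πξ²: the Jacobian 4πξ is at least l on the half-line, so l⁻¹ times it is at
least 1 and may be inserted. -/
theorem lintegral_comp_two_pi_mul_sq_le (hl : 0 < l) (Q : ℝ → ℝ≥0∞) :
    ∫⁻ ξ in Ici l, Q (2 * π * ξ ^ 2) ≤ ENNReal.ofReal l⁻¹ * ∫⁻ η, Q η := by
  have hs : MeasurableSet (Ici l) := measurableSet_Ici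
  calc ∫⁻ ξ in Ici l, Q (2 * π * ξ ^ 2)
      ≤ ∫⁻ ξ in Ici l, ENNReal.ofReal l⁻¹ * (ENNReal.ofReal |4 * π * ξ| * Q (2 * π * ξ ^ 2)) := by
        refine setLIntegral_mono' hs fun ξ hξ => ?_
        have hξ' : l ≤ ξ := hξ
        rw [← mul_assoc, ← ENNReal.ofReal_mul (by positivity)]
        refine le_mul_of_one_le_left zero_le ?_
        rw [ENNReal.one_le_ofReal, abs_of_nonneg (by have := hl.le.trans hξ'; positivity),
          inv_mul_eq_div, one_le_div hl]
        nlinarith [pi_gt_three]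
    _ = ENNReal.ofReal l⁻¹ * ∫⁻ η in (fun ξ : ℝ => 2 * π * ξ ^ 2) '' Ici l, Q η := by
        rw [lintegral_const_mul' _ _ ENNReal.ofReal_ne_top,
          lintegral_image_eq_lintegral_abs_deriv_mul hs
            (fun ξ _ => (hasDerivAt_two_pi_mul_sq ξ).hasDerivWithinAt) (injOn_two_pi_mul_sq hl)]
    _ ≤ _ := by gcongr; exact Measure.restrict_le_self

theorem fourierInv_real_eq (h : ℝ → ℂ) (t : ℝ) : 𝓕⁻ h t = ∫ s, 𝐞 (t * s) • h s := by
  rw [Real.fourierInv_eq]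
  rfl

/-- Restriction of the Fourier transform to the parabola. -/
theorem lintegral_restriction_le (hl : 0 < l) {h : ℝ → ℂ} (hh : Integrable h) :
    ∫⁻ ξ in Ici l, ‖∫ t, 𝐞 (2 * π * t * ξ ^ 2) • h t‖ₑ ^ 2 ≤
      ENNReal.ofReal l⁻¹ * eLpNorm h 2 volume ^ 2 := by
  calc ∫⁻ ξ in Ici l, ‖∫ t, 𝐞 (2 * π * t * ξ ^ 2) • h t‖ₑ ^ 2
      = ∫⁻ ξ in Ici l, ‖𝓕⁻ h (2 * π * ξ ^ 2)‖ₑ ^ 2 := by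
        refine lintegral_congr fun ξ => ?_
        rw [fourierInv_real_eq]
        congr 4 with t
        congr 2
        ring
    _ ≤ ENNReal.ofReal l⁻¹ * ∫⁻ η, ‖𝓕⁻ h η‖ₑ ^ 2 :=
        lintegral_comp_two_pi_mul_sq_le hl (fun η => ‖𝓕⁻ h η‖ₑ ^ 2)
    _ ≤ _ := by
        rw [← eLpNorm_two_sq]
        gcongr
        exact eLpNorm_fourierInv_le hh

theorem lintegral_restriction_neg_le (hl : 0 < l) {h : ℝ → ℂ} (hh : Integrable h) :
    ∫⁻ ξ in Ici l, ‖∫ t, 𝐞 (-(2 * π * t * ξ ^ 2)) • h t‖ₑ ^ 2 ≤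
      ENNReal.ofReal l⁻¹ * eLpNorm h 2 volume ^ 2 := by
  have h1 := lintegral_restriction_le hl hh.comp_neg
  have h2 : eLpNorm (fun t => h (-t)) 2 volume = eLpNorm h 2 volume :=
    eLpNorm_comp_measurePreserving hh.1 (Measure.measurePreserving_neg volume)
  rw [h2] at h1
  refine (lintegral_congr fun ξ => ?_).trans_le h1
  rw [← integral_neg_eq_self]
  simp

/-- The dual estimate: extension from the parabola. -/
theorem eLpNorm_extension_sq_le (hl : 0 < l) {g : ℝ → ℂ} (hg : Integrable g)
    (hsupp : ∀ ξ < l, g ξ = 0) :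
    eLpNorm (fun t => ∫ ξ, 𝐞 (2 * π * t * ξ ^ 2) • g ξ) 2 volume ^ 2 ≤
      ENNReal.ofReal l⁻¹ * eLpNorm g 2 volume ^ 2 := by
  set f : ℝ → ℝ := fun ξ => 2 * π * ξ ^ 2 with hf
  set r : ℝ → ℝ := fun η => √(η / (2 * π)) with hr
  have hrf : ∀ ξ ∈ Ici l, r (f ξ) = ξ := fun ξ hξ => by
    have : 2 * π * ξ ^ 2 / (2 * π) = ξ ^ 2 := by field_simp
    simp only [hr, hf, this]
    exact sqrt_sq (hl.le.trans hξ)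
  have hs : MeasurableSet (Ici l) := measurableSet_Ici
  have hd : ∀ ξ ∈ Ici l, HasDerivWithinAt f (4 * π * ξ) (Ici l) ξ :=
    fun ξ _ => (hasDerivAt_two_pi_mul_sq ξ).hasDerivWithinAt
  have hinj := injOn_two_pi_mul_sq hl
  have him : MeasurableSet (f '' Ici l) :=
    measurable_image_of_fderivWithin hs (fun x hx => (hd x hx).hasFDerivWithinAt) hinj
  -- `G` is `g` in the variable η = 2πξ², divided by the Jacobian, so that the extension is an
  -- inverse Fourier transform of `G`. In the L² norm one Jacobian from the measure meets two from
  -- |G|², leaving 1/(4πξ) ≤ 1/l.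
  set G : ℝ → ℂ := fun η => ((4 * π * r η)⁻¹ : ℝ) • g (r η) with hG
  have hpos : ∀ ξ ∈ Ici l, 0 < 4 * π * ξ := fun ξ hξ => by
    have : 0 < ξ := hl.trans_le hξ
    positivity
  have hGf : ∀ ξ ∈ Ici l, |4 * π * ξ| • G (f ξ) = g ξ := fun ξ hξ => by
    rw [hG]
    simp only [hrf ξ hξ]
    rw [abs_of_pos (hpos ξ hξ), smul_smul, mul_inv_cancel₀ (hpos ξ hξ).ne', one_smul]
  have hGint : Integrable ((f '' Ici l).indicator G) := by
    rw [integrable_indicator_iff him,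
      integrableOn_image_iff_integrableOn_abs_deriv_smul hs hd hinj]
    exact hg.integrableOn.congr_fun (fun ξ hξ => (hGf ξ hξ).symm) hs
  have hE : ∀ t, ∫ ξ, 𝐞 (2 * π * t * ξ ^ 2) • g ξ = 𝓕⁻ ((f '' Ici l).indicator G) t := by
    intro t
    rw [fourierInv_real_eq]
    have : ∀ η, 𝐞 (t * η) • (f '' Ici l).indicator G η =
        (f '' Ici l).indicator (fun η => 𝐞 (t * η) • G η) η := fun η => by
      by_cases h : η ∈ f '' Ici l <;> simp [h]
    simp_rw [this]
    rw [integral_indicator him, integral_image_eq_integral_abs_deriv_smul hs hd hinj,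
      ← integral_indicator hs]
    congr 1 with ξ
    by_cases hξ : ξ ∈ Ici l
    · rw [indicator_of_mem hξ, smul_comm, hGf ξ hξ]
      congr 2
      simp only [hf]; ring
    · rw [indicator_of_notMem hξ, hsupp ξ (by simpa using hξ), smul_zero]
  simp_rw [hE]
  calc eLpNorm (𝓕⁻ ((f '' Ici l).indicator G)) 2 volume ^ 2
      ≤ eLpNorm ((f '' Ici l).indicator G) 2 volume ^ 2 := by
        gcongr
        exact eLpNorm_fourierInv_le hGint
    _ = ∫⁻ η in f '' Ici l, ‖G η‖ₑ ^ 2 := by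
        rw [eLpNorm_two_sq, ← lintegral_indicator him]
        refine lintegral_congr fun η => ?_
        by_cases h : η ∈ f '' Ici l <;> simp [h]
    _ = ∫⁻ ξ in Ici l, ENNReal.ofReal |4 * π * ξ| * ‖G (f ξ)‖ₑ ^ 2 :=
        lintegral_image_eq_lintegral_abs_deriv_mul hs hd hinj _
    _ ≤ ∫⁻ ξ in Ici l, ENNReal.ofReal l⁻¹ * ‖g ξ‖ₑ ^ 2 := by
        refine setLIntegral_mono' hs fun ξ hξ => ?_
        have hξ' : l ≤ ξ := hξ
        have hp := hpos ξ hξ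
        rw [hG]
        simp only [hrf ξ hξ]
        rw [enorm_smul, mul_pow, ← mul_assoc, Real.enorm_eq_ofReal (by positivity),
          ← ENNReal.ofReal_pow (by positivity), ← ENNReal.ofReal_mul (by positivity),
          abs_of_pos hp]
        gcongr
        rw [sq, ← mul_assoc, mul_inv_cancel₀ hp.ne', one_mul]
        exact inv_anti₀ hl (by nlinarith [pi_gt_three])
    _ ≤ _ := by
        rw [lintegral_const_mul' _ _ ENNReal.ofReal_ne_top, eLpNorm_two_sq]
        gcongr
        exact Measure.restrict_le_self

end Parabola

/-! ### Decay of the frequency-localized kernel -/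

section Kernel

/-- A smooth cutoff which equals `1` on `[2/5, 2]` and is supported in `[1/5, 11/5]`. -/
def bump : ContDiffBump (6 / 5 : ℝ) where
  rIn := 4 / 5
  rOut := 1
  rIn_pos := by norm_num
  rIn_lt_rOut := by norm_num

theorem bump_eq_one {r : ℝ} (h : 2 / 5 ≤ r) (h' : r ≤ 2) : bump r = 1 := by
  apply bump.one_of_mem_closedBall
  rw [Metric.mem_closedBall, Real.dist_eq, abs_le]
  constructor <;> norm_num [bump] <;> linarith

theorem bump_eq_zero {r : ℝ} (h : r ≤ 1 / 5 ∨ 11 / 5 ≤ r) : bump r = 0 := by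
  apply bump.zero_of_le_dist
  rw [Real.dist_eq, le_abs]
  rcases h with h | h
  · right; norm_num [bump]; linarith
  · left; norm_num [bump]; linarith

theorem continuous_bump : Continuous (bump : ℝ → ℝ) := (bump.contDiff (n := 0)).continuous

theorem integrable_bump : Integrable (bump : ℝ → ℝ) :=
  continuous_bump.integrable_of_hasCompactSupport bump.hasCompactSupport

theorem deriv_bump_eq_zero {r : ℝ} (h : r < 1 / 5 ∨ 11 / 5 < r) : deriv bump r = 0 := by
  have : (bump : ℝ → ℝ) =ᶠ[nhds r] fun _ => 0 := by
    rcases h with h | h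
    · filter_upwards [Iio_mem_nhds h] with x hx using bump_eq_zero (.inl (le_of_lt hx))
    · filter_upwards [Ioi_mem_nhds h] with x hx using bump_eq_zero (.inr (le_of_lt hx))
  rw [this.deriv_eq, deriv_const]

/-- The integral `∫ e^{2πi(ξz + 2πtξ²)} ψ(ξ/m) dξ`, with `ψ = bump`. -/
def kernel (m t z : ℝ) : ℂ := ∫ ξ : ℝ, 𝐞 (ξ * z + 2 * π * t * ξ ^ 2) • (bump (ξ / m) : ℂ)

theorem norm_kernel_le (m t z : ℝ) : ‖kernel m t z‖ ≤ ∫ ξ : ℝ, bump (ξ / m) := by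
  refine (norm_integral_le_integral_norm _).trans_eq (integral_congr_ae (.of_forall fun ξ => ?_))
  simp [abs_of_nonneg bump.nonneg]

theorem norm_kernel_neg (m t z : ℝ) : ‖kernel m (-t) (-z)‖ = ‖kernel m t z‖ := by
  have : kernel m (-t) (-z) = star (kernel m t z) := by
    unfold kernel
    rw [← starRingEnd_apply, ← integral_conj]
    congr 1 with ξ
    rw [Circle.smul_def, Circle.smul_def, smul_eq_mul, smul_eq_mul, map_mul, Complex.conj_ofReal,
      Circle.starRingEnd_addChar]
    congr 3
    ring
  rw [this, norm_star]

/-- Parabolic scaling ξ ↦ mξ; it reduces the kernel bounds to m = 1. -/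
theorem kernel_scale {m : ℝ} (hm : 0 < m) (t z : ℝ) :
    kernel m t z = m * kernel 1 (m ^ 2 * t) (m * z) := by
  unfold kernel
  have := Measure.integral_comp_mul_right
    (fun ξ : ℝ => 𝐞 (ξ * z + 2 * π * t * ξ ^ 2) • (bump (ξ / m) : ℂ)) m
  rw [abs_of_pos (inv_pos.2 hm)] at this
  have h2 : ∀ ξ : ℝ, 𝐞 (ξ * m * z + 2 * π * t * (ξ * m) ^ 2) • (bump (ξ * m / m) : ℂ) =
    𝐞 (ξ * (m * z) + 2 * π * (m ^ 2 * t) * ξ ^ 2) • (bump (ξ / 1) : ℂ) := fun ξ => by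
    rw [mul_div_cancel_right₀ _ hm.ne', div_one]
    congr 2; ring
  simp_rw [h2] at this
  rw [this, Complex.real_smul, ← mul_assoc, ← Complex.ofReal_mul, mul_inv_cancel₀ hm.ne']
  simp

/-- Nonstationary phase: for z ≥ 0 the phase derivative p(ξ) = 2πz + βξ, with β = 8π²t, is at least
β/10 on [1/10, 3], so two integrations by parts gain β⁻² uniformly in z. -/
theorem norm_kernel_one_le_of_pos : ∃ C : ℝ, ∀ t z : ℝ, 0 < t → 0 ≤ z →
    ‖kernel 1 t z‖ ≤ C / t ^ 2 := by
  have hd1 : ContDiff ℝ ∞ (deriv bump) := by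
    have : ContDiff ℝ ∞ (bump : ℝ → ℝ) := bump.contDiff
    exact ContDiff.deriv' this
  have hd : ∀ r, HasDerivAt bump (deriv bump r) r := fun r =>
    ((bump.contDiff (n := 1)).differentiable (by norm_num) r).hasDerivAt
  have hd' : ∀ r, HasDerivAt (deriv bump) (deriv (deriv bump) r) r := fun r =>
    (hd1.differentiable (by norm_num) r).hasDerivAt
  have hc2 : Continuous (deriv (deriv bump)) := hd1.continuous_deriv (by norm_num)
  obtain ⟨M0, hM0⟩ := isCompact_Icc.exists_bound_of_continuousOn
    (s := Icc (1 / 10 : ℝ) 3) continuous_bump.continuousOn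
  obtain ⟨M1, hM1⟩ := isCompact_Icc.exists_bound_of_continuousOn
    (s := Icc (1 / 10 : ℝ) 3) hd1.continuous.continuousOn
  obtain ⟨M2, hM2⟩ := isCompact_Icc.exists_bound_of_continuousOn
    (s := Icc (1 / 10 : ℝ) 3) hc2.continuousOn
  -- The powers of 10 come from p ≥ β/10 in the three terms of `R`; the final 3 bounds the length of
  -- [1/10, 3].
  refine ⟨(M2 * 100 + 3 * M1 * 1000 + 3 * M0 * 10000) * 3, fun t z ht hz => ?_⟩
  set β : ℝ := 8 * π ^ 2 * t with hβ
  have hβt : t ≤ β := by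
    have : 1 ≤ 8 * π ^ 2 := by nlinarith [pi_gt_three]
    exact le_mul_of_one_le_left ht.le this
  have hβ0 : 0 < β := ht.trans_le hβt
  set p : ℝ → ℝ := fun ξ => 2 * π * z + β * ξ with hp
  have hpβ : ∀ ξ ∈ Icc (1 / 10 : ℝ) 3, β / 10 ≤ p ξ := fun ξ hξ => by
    have : 0 ≤ 2 * π * z := by positivity
    have : β * (1 / 10) ≤ β * ξ := by gcongr; exact hξ.1
    simp only [hp]; linarith
  set E : ℝ → ℂ := fun ξ => Complex.exp (((2 * π * (ξ * z + 2 * π * t * ξ ^ 2) : ℝ) : ℂ) *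
    Complex.I) with hE
  have hP : ∀ ξ, HasDerivAt (fun ξ => (p ξ : ℂ)) β ξ := fun ξ => by
    refine HasDerivAt.ofReal_comp ?_
    exact (((hasDerivAt_id' ξ).const_mul β).const_add (2 * π * z)).congr_deriv (mul_one β)
  have hEd : ∀ ξ, HasDerivAt E (E ξ * (p ξ * Complex.I)) ξ := fun ξ => by
    refine HasDerivAt.cexp (HasDerivAt.mul_const ?_ _)
    refine HasDerivAt.ofReal_comp ?_
    refine ((((hasDerivAt_id' ξ).mul_const z).add
      (((hasDerivAt_id' ξ).pow 2).const_mul (2 * π * t))).const_mul (2 * π)).congr_deriv ?_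
    simp only [hp, hβ]
    norm_num
    ring
  -- Both integrations by parts are done at once: R = (p⁻¹(bump/p)')', and `B` collects the boundary
  -- terms, so that (E B)' = E (bump + R).
  set R : ℝ → ℂ := fun ξ => ((deriv (deriv bump) ξ : ℝ) : ℂ) / (p ξ : ℂ) ^ 2 -
    3 * β * ((deriv bump ξ : ℝ) : ℂ) / (p ξ : ℂ) ^ 3 + 3 * β ^ 2 * (bump ξ : ℂ) / (p ξ : ℂ) ^ 4 with hR
  set B : ℝ → ℂ := fun ξ => -Complex.I * (bump ξ : ℂ) / (p ξ : ℂ) +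
    ((deriv bump ξ : ℝ) : ℂ) / (p ξ : ℂ) ^ 2 - β * (bump ξ : ℂ) / (p ξ : ℂ) ^ 3 with hB
  have hp0 : ∀ ξ ∈ Icc (1 / 10 : ℝ) 3, p ξ ≠ 0 := fun ξ hξ => by
    have := hpβ ξ hξ; linarith [show 0 < β / 10 by positivity] |> ne_of_gt
  have hBd : ∀ ξ ∈ Icc (1 / 10 : ℝ) 3,
      HasDerivAt (fun ξ => E ξ * B ξ) (E ξ * (bump ξ + R ξ)) ξ := fun ξ hξ => by
    have hp' : (p ξ : ℂ) ≠ 0 := by exact_mod_cast hp0 ξ hξ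
    have h1 := (hd ξ).ofReal_comp
    have h2 := (hd' ξ).ofReal_comp
    refine ((hEd ξ).mul ((((h1.const_mul (-Complex.I)).div (hP ξ) hp').add
      (h2.div ((hP ξ).pow 2) (pow_ne_zero 2 hp'))).sub
      ((h1.const_mul (β : ℂ)).div ((hP ξ).pow 3) (pow_ne_zero 3 hp')))).congr_deriv ?_
    simp only [hR, Pi.add_apply, Pi.sub_apply, Pi.div_apply]
    have hI : Complex.I ^ 2 = -1 := Complex.I_sq
    push_cast
    norm_num
    field_simp
    ring_nf
    rw [hI]
    ring_nf
  have hRc : ContinuousOn R (Icc (1 / 10 : ℝ) 3) := by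
    have hpc : Continuous (fun ξ => (p ξ : ℂ)) := by
      rw [continuous_iff_continuousAt]; exact fun ξ => (hP ξ).continuousAt
    have b0 : Continuous (fun ξ => (bump ξ : ℂ)) := Complex.continuous_ofReal.comp continuous_bump
    have b1 : Continuous (fun ξ => ((deriv bump ξ : ℝ) : ℂ)) :=
      Complex.continuous_ofReal.comp hd1.continuous
    have b2 : Continuous (fun ξ => ((deriv (deriv bump) ξ : ℝ) : ℂ)) :=
      Complex.continuous_ofReal.comp hc2
    have hp' : ∀ n : ℕ, ∀ ξ ∈ Icc (1 / 10 : ℝ) 3, (p ξ : ℂ) ^ n ≠ 0 := fun n ξ hξ =>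
      pow_ne_zero n (by exact_mod_cast hp0 ξ hξ)
    exact ((b2.continuousOn.div (hpc.pow 2).continuousOn (hp' 2)).sub
      ((continuous_const.mul b1).continuousOn.div (hpc.pow 3).continuousOn (hp' 3))).add
      ((continuous_const.mul b0).continuousOn.div (hpc.pow 4).continuousOn (hp' 4))
  have hRb : ∀ ξ ∈ Icc (1 / 10 : ℝ) 3, ‖R ξ‖ ≤
      (M2 * 100 + 3 * M1 * 1000 + 3 * M0 * 10000) / β ^ 2 := fun ξ hξ => by
    have hpξ := hpβ ξ hξ
    have hpp : 0 < β / 10 := by positivity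
    have hpp' : 0 < p ξ := hpp.trans_le hpξ
    have e : (M2 * 100 + 3 * M1 * 1000 + 3 * M0 * 10000) / β ^ 2 = M2 / (β / 10) ^ 2 +
        3 * β * M1 / (β / 10) ^ 3 + 3 * β ^ 2 * M0 / (β / 10) ^ 4 := by
      field_simp
      ring
    have m0 : 0 ≤ M0 := (norm_nonneg _).trans (hM0 ξ hξ)
    have m1 : 0 ≤ M1 := (norm_nonneg _).trans (hM1 ξ hξ)
    have m2 : 0 ≤ M2 := (norm_nonneg _).trans (hM2 ξ hξ)
    rw [e]
    refine (norm_add_le _ _).trans (add_le_add ((norm_sub_le _ _).trans (add_le_add ?_ ?_)) ?_)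
    · rw [norm_div, norm_pow, Complex.norm_real, Complex.norm_real, norm_of_nonneg hpp'.le]
      gcongr
      exact hM2 ξ hξ
    · simp only [norm_div, norm_pow, norm_mul, Complex.norm_real, norm_of_nonneg hpp'.le,
        norm_of_nonneg hβ0.le, Complex.norm_ofNat]
      gcongr
      exact hM1 ξ hξ
    · simp only [norm_div, norm_pow, norm_mul, Complex.norm_real, norm_of_nonneg hpp'.le,
        norm_of_nonneg hβ0.le, Complex.norm_ofNat]
      gcongr
      exact hM0 ξ hξ
  have hEc : Continuous E := by
    rw [continuous_iff_continuousAt]; exact fun ξ => (hEd ξ).continuousAt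
  have hbc : Continuous (fun ξ => (bump ξ : ℂ)) := Complex.continuous_ofReal.comp continuous_bump
  have hu : uIcc (1 / 10 : ℝ) 3 = Icc (1 / 10 : ℝ) 3 := uIcc_of_le (by norm_num)
  -- The support [1/5, 11/5] of `bump` lies strictly inside [1/10, 3], so there is no boundary
  -- contribution.
  have hB0 : B (1 / 10) = 0 ∧ B 3 = 0 := by
    simp only [hB]
    rw [bump_eq_zero (r := 3) (by norm_num), bump_eq_zero (r := 1 / 10) (by norm_num),
      deriv_bump_eq_zero (r := 3) (by norm_num), deriv_bump_eq_zero (r := 1 / 10) (by norm_num)]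
    simp
  have hi1 : IntervalIntegrable (fun ξ => E ξ * bump ξ) volume (1 / 10) 3 :=
    (hEc.mul hbc).intervalIntegrable _ _
  have hi2 : IntervalIntegrable (fun ξ => E ξ * R ξ) volume (1 / 10) 3 :=
    (hEc.continuousOn.mul (hu ▸ hRc)).intervalIntegrable
  have hkey : ∫ ξ in (1 / 10 : ℝ)..3, (E ξ * bump ξ + E ξ * R ξ) = 0 := by
    rw [intervalIntegral.integral_eq_sub_of_hasDerivAt (f := fun ξ => E ξ * B ξ) _ (hi1.add hi2)]
    · change E 3 * B 3 - E (1 / 10) * B (1 / 10) = 0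
      rw [hB0.1, hB0.2, mul_zero, mul_zero, sub_zero]
    · intro ξ hξ
      rw [← mul_add]
      exact hBd ξ (hu ▸ hξ)
  rw [intervalIntegral.integral_add hi1 hi2, add_eq_zero_iff_eq_neg] at hkey
  have hk : kernel 1 t z = ∫ ξ in (1 / 10 : ℝ)..3, E ξ * bump ξ := by
    rw [intervalIntegral.integral_of_le (by norm_num), ← integral_indicator measurableSet_Ioc]
    unfold kernel
    congr 1 with ξ
    by_cases hξ : ξ ∈ Ioc (1 / 10 : ℝ) 3
    · rw [indicator_of_mem hξ, div_one, Circle.smul_def, fourierChar_apply, smul_eq_mul]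
    · have : bump (ξ / 1) = 0 := by
        rw [mem_Ioc, not_and_or, not_lt, not_le] at hξ
        exact bump_eq_zero (hξ.imp (by intro; linarith) (by intro; linarith))
      rw [indicator_of_notMem hξ, this]
      simp
  rw [hk, hkey, norm_neg]
  have hK : 0 ≤ M2 * 100 + 3 * M1 * 1000 + 3 * M0 * 10000 := by
    have h1 : (1 : ℝ) ∈ Icc (1 / 10 : ℝ) 3 := by constructor <;> norm_num
    have m0 : 0 ≤ M0 := (norm_nonneg _).trans (hM0 1 h1)
    have m1 : 0 ≤ M1 := (norm_nonneg _).trans (hM1 1 h1)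
    have m2 : 0 ≤ M2 := (norm_nonneg _).trans (hM2 1 h1)
    positivity
  refine (intervalIntegral.norm_integral_le_of_norm_le_const (C :=
    (M2 * 100 + 3 * M1 * 1000 + 3 * M0 * 10000) / t ^ 2) fun ξ hξ => ?_).trans ?_
  · rw [uIoc_of_le (by norm_num)] at hξ
    rw [norm_mul, Complex.norm_exp_ofReal_mul_I, one_mul]
    refine (hRb ξ ⟨hξ.1.le, hξ.2⟩).trans ?_
    gcongr
  · rw [div_mul_eq_mul_div]
    gcongr
    rw [abs_of_nonneg] <;> norm_num

/-- The mass of `bump` bounds the kernel itself and nonstationary phase bounds t² times it;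
conjugation reduces t < 0 to t > 0. -/
theorem norm_kernel_one_le : ∃ C : ℝ, 0 ≤ C ∧ ∀ t z : ℝ, 0 ≤ t * z →
    ‖kernel 1 t z‖ ≤ C / (1 + t ^ 2) := by
  obtain ⟨C, hC⟩ := norm_kernel_one_le_of_pos
  set D := ∫ ξ : ℝ, bump (ξ / 1) with hD
  have hD0 : 0 ≤ D := integral_nonneg fun ξ => bump.nonneg
  refine ⟨|C| + D, by positivity, fun t z htz => ?_⟩
  rw [le_div_iff₀ (by positivity), mul_add, mul_one]
  have h1 : ‖kernel 1 t z‖ ≤ D := norm_kernel_le 1 t z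
  suffices ‖kernel 1 t z‖ * t ^ 2 ≤ |C| by linarith
  rcases lt_trichotomy t 0 with ht | rfl | ht
  · have hz : z ≤ 0 := by nlinarith
    have := hC (-t) (-z) (by linarith) (by linarith)
    rw [norm_kernel_neg, le_div_iff₀ (by nlinarith), neg_sq] at this
    exact this.trans (le_abs_self C)
  · simp
  · have hz : 0 ≤ z := by nlinarith
    have := hC t z ht hz
    rw [le_div_iff₀ (by positivity)] at this
    exact this.trans (le_abs_self C)

theorem norm_kernel_le_cauchy : ∃ C : ℝ, 0 ≤ C ∧ ∀ m t z : ℝ, 0 < m → 0 ≤ t * z →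
    ‖kernel m t z‖ ≤ m * (C / (1 + (m ^ 2 * t) ^ 2)) := by
  obtain ⟨C, hC0, hC⟩ := norm_kernel_one_le
  refine ⟨C, hC0, fun m t z hm htz => ?_⟩
  rw [kernel_scale hm, norm_mul, Complex.norm_real, norm_eq_abs, abs_of_pos hm]
  gcongr
  refine hC _ _ ?_
  have : m ^ 2 * t * (m * z) = m ^ 3 * (t * z) := by ring
  rw [this]; positivity

end Kernel

/-! ### L² bounds for full and retarded time convolutions -/

section Convolution

theorem continuous_kernel (m : ℝ) (hm : m ≠ 0) :
    Continuous (fun p : ℝ × ℝ => kernel m p.1 p.2) := by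
  unfold kernel
  have hb : Continuous (fun ξ : ℝ => (bump (ξ / m) : ℂ)) :=
    Complex.continuous_ofReal.comp (continuous_bump.comp (continuous_id.div_const m))
  refine continuous_of_dominated (bound := fun ξ => bump (ξ / m)) (fun p => ?_) (fun p => ?_)
    (integrable_bump.comp_div hm) (.of_forall fun ξ => ?_)
  · refine Continuous.aestronglyMeasurable ?_
    fun_prop
  · refine .of_forall fun ξ => ?_
    simp [abs_of_nonneg bump.nonneg]
  · fun_prop

theorem continuous_kernel_comp {α : Type*} [TopologicalSpace α] {m : ℝ} (hm : m ≠ 0)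
    {a b : α → ℝ} (ha : Continuous a) (hb : Continuous b) :
    Continuous (fun x => kernel m (a x) (b x)) :=
  (continuous_kernel m hm).comp (ha.prodMk hb)

/-- Young's inequality `L¹ * L² ⊆ L²`. -/
theorem eLpNorm_two_convolution_le {κ a : ℝ → ℝ≥0∞} (hκ : Measurable κ) (ha : Measurable a) :
    eLpNorm (fun t => ∫⁻ s, κ (t - s) * a s) 2 volume ≤ (∫⁻ r, κ r) * eLpNorm a 2 volume := by
  have h1 : ∀ t, ∫⁻ s, κ (t - s) * a s = ∫⁻ r, κ r * a (t - r) := fun t => by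
    rw [← lintegral_sub_left_eq_self _ t]
    simp
  simp_rw [h1]
  refine (eLpNorm_two_lintegral_le (by fun_prop)).trans ?_
  rw [← lintegral_mul_const _ hκ]
  refine lintegral_mono fun r => le_of_sq_le_sq ?_
  rw [mul_pow, eLpNorm_two_sq, eLpNorm_two_sq, ← lintegral_const_mul _ (by fun_prop),
    ← lintegral_sub_right_eq_self (fun s => κ r ^ 2 * ‖a s‖ₑ ^ 2) r]
  simp [mul_pow]

theorem integrable_char_smul {α : Type*} [MeasurableSpace α] {μ : Measure α} {f : α → ℂ}
    (hf : Integrable f μ) {θ : α → ℝ} (hθ : Measurable θ) :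
    Integrable (fun x => 𝐞 (θ x) • f x) μ := by
  refine hf.mono ?_ (.of_forall fun x => by simp)
  have : Continuous (fun x : ℝ => (𝐞 x : ℂ)) := by fun_prop
  exact (this.stronglyMeasurable.comp_measurable hθ).aestronglyMeasurable.mul hf.1

theorem stronglyMeasurable_parametric {α : Type*} [MeasurableSpace α] {h : ℝ → ℂ}
    (hm : StronglyMeasurable h) {θ : α → ℝ → ℝ} (hθ : Measurable (Function.uncurry θ)) :
    StronglyMeasurable (fun x => ∫ s, 𝐞 (θ x s) • h s) := by
  have : StronglyMeasurable (fun p : α × ℝ => 𝐞 (θ p.1 p.2) • h p.2) := by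
    simp_rw [Circle.smul_def, smul_eq_mul]
    refine StronglyMeasurable.mul ?_ (hm.comp_measurable measurable_snd)
    have : Continuous (fun x : ℝ => (𝐞 x : ℂ)) := by fun_prop
    exact this.stronglyMeasurable.comp_measurable hθ
  exact this.integral_prod_right'

/-- The convolution with the kernel in time is bounded on `L²`, uniformly in `z`. -/
theorem eLpNorm_kernel_convolution_le {m : ℝ} (hm : 0 < m) (z : ℝ) {h : ℝ → ℂ}
    (hmeas : StronglyMeasurable h) (hh : Integrable h) :
    eLpNorm (fun t => ∫ s, kernel m (t - s) z * h s) 2 volume ≤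
      ENNReal.ofReal (5 / m) * eLpNorm h 2 volume := by
  set Q : ℝ → ℂ := fun ξ => ∫ s, 𝐞 (-(2 * π * s * ξ ^ 2)) • h s with hQ
  have hQm : StronglyMeasurable Q := stronglyMeasurable_parametric hmeas (by fun_prop)
  have hQb : ∀ ξ, ‖Q ξ‖ ≤ ∫ s, ‖h s‖ := fun ξ =>
    (norm_integral_le_integral_norm _).trans_eq (by simp)
  set g : ℝ → ℂ := fun ξ => 𝐞 (ξ * z) • ((bump (ξ / m) : ℂ) * Q ξ) with hg
  have hbm : Integrable (fun ξ : ℝ => (bump (ξ / m) : ℂ)) :=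
    (integrable_bump.comp_div hm.ne').ofReal
  have hgi : Integrable g :=
    integrable_char_smul (hbm.mul_bdd hQm.aestronglyMeasurable (.of_forall hQb)) (by fun_prop)
  -- `bump (ξ / m)` vanishes for ξ < m/5. Extension and restriction are both used with l = m/5, each
  -- contributing (5/m)^(1/2).
  have hm5 : 0 < m / 5 := by positivity
  have hsupp : ∀ ξ < m / 5, bump (ξ / m) = 0 := fun ξ hξ => by
    refine bump_eq_zero (.inl ?_)
    rw [div_le_iff₀ hm]; linarith
  -- Splitting the phase e(2π(t - s)ξ²) exhibits the convolution as a restriction in s followed by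
  -- an extension in t.
  have hfull : ∀ t, ∫ s, kernel m (t - s) z * h s = ∫ ξ, 𝐞 (2 * π * t * ξ ^ 2) • g ξ := by
    intro t
    unfold kernel
    simp_rw [← integral_mul_const]
    rw [integral_integral_swap]
    · refine integral_congr_ae (.of_forall fun ξ => ?_)
      simp only [hg, hQ, Circle.smul_def, smul_eq_mul, ← integral_const_mul]
      congr 1 with s
      have : 𝐞 (ξ * z + 2 * π * (t - s) * ξ ^ 2) =
          𝐞 (2 * π * t * ξ ^ 2) * 𝐞 (ξ * z) * 𝐞 (-(2 * π * s * ξ ^ 2)) := by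
        rw [← AddChar.map_add_eq_mul, ← AddChar.map_add_eq_mul]
        congr 1; ring
      rw [this, Circle.coe_mul, Circle.coe_mul]
      ring
    · refine (integrable_char_smul (hbm.mul_prod hh).swap
        (θ := fun p : ℝ × ℝ => p.2 * z + 2 * π * (t - p.1) * p.2 ^ 2) (by fun_prop)).congr ?_
      exact .of_forall fun p => by simp [Function.uncurry, Circle.smul_def, mul_assoc]
  simp_rw [hfull]
  refine le_of_sq_le_sq ?_
  refine (eLpNorm_extension_sq_le hm5 hgi fun ξ hξ => ?_).trans ?_
  · simp [hg, hsupp ξ hξ]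
  have hi : (m / 5)⁻¹ = 5 / m := inv_div _ _
  rw [mul_pow, sq (ENNReal.ofReal _), mul_assoc, ← hi]
  gcongr
  refine le_trans ?_ (lintegral_restriction_neg_le hm5 hh)
  rw [eLpNorm_two_sq, ← lintegral_indicator measurableSet_Ici]
  refine lintegral_mono fun ξ => ?_
  by_cases hξ : ξ ∈ Ici (m / 5)
  · rw [indicator_of_mem hξ]
    gcongr
    rw [← ofReal_norm, ← ofReal_norm]
    refine ENNReal.ofReal_le_ofReal ?_
    rw [hg]
    simp only [Circle.norm_smul, norm_mul, Complex.norm_real, norm_of_nonneg bump.nonneg]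
    exact mul_le_of_le_one_left (norm_nonneg _) bump.le_one
  · simp [hg, hsupp ξ (by simpa using hξ)]

/-- The retarded convolution with the kernel in time is bounded on `L²`, uniformly in `z`. -/
theorem eLpNorm_retarded_kernel_convolution_le : ∃ C : ℝ≥0, ∀ m : ℝ, 0 < m → ∀ z : ℝ,
    ∀ h : ℝ → ℂ, StronglyMeasurable h → Integrable h →
    eLpNorm (fun t => ∫ s in Iio t, kernel m (t - s) z * h s) 2 volume ≤
      C * ENNReal.ofReal m⁻¹ * eLpNorm h 2 volume := by
  obtain ⟨C, hC0, hC⟩ := norm_kernel_le_cauchy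
  -- 5 comes from the untruncated convolution, Cπ from the L¹ norm of the majorant `κ`.
  refine ⟨Real.toNNReal (5 + C * π), fun m hm z h hmeas hh => ?_⟩
  set κ : ℝ → ℝ≥0∞ := fun r => ENNReal.ofReal (m * (C / (1 + (m ^ 2 * r) ^ 2))) with hκ
  have hκm : Measurable κ := by fun_prop
  have hkm : Continuous (fun p : ℝ × ℝ => kernel m (p.1 - p.2) z) :=
    continuous_kernel_comp hm.ne' (by fun_prop) (by fun_prop)
  have hκint : ∫⁻ r, κ r = ENNReal.ofReal (C * π / m) := by
    have hm2 : m ^ 2 ≠ 0 := by positivity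
    have e : ∀ r, m * (C / (1 + (m ^ 2 * r) ^ 2)) = m * C * (1 + (m ^ 2 * r) ^ 2)⁻¹ :=
      fun r => by ring
    simp_rw [hκ, e]
    rw [← ofReal_integral_eq_lintegral_ofReal
      ((integrable_inv_one_add_sq.comp_mul_left' hm2).const_mul _)
      (.of_forall fun r => by positivity), integral_const_mul,
      Measure.integral_comp_mul_left (fun x : ℝ => (1 + x ^ 2)⁻¹), integral_univ_inv_one_add_sq,
      abs_of_pos (by positivity), smul_eq_mul]
    congr 1
    field_simp
  have hki : ∀ t, Integrable (fun s => kernel m (t - s) z * h s) := fun t => by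
    have hk : Continuous (fun s => kernel m (t - s) z) :=
      continuous_kernel_comp hm.ne' (by fun_prop) (by fun_prop)
    exact hh.bdd_mul hk.aestronglyMeasurable (.of_forall fun s => norm_kernel_le m (t - s) z)
  have hfm : StronglyMeasurable (fun t => ∫ s, kernel m (t - s) z * h s) := by
    have : StronglyMeasurable (fun p : ℝ × ℝ => kernel m (p.1 - p.2) z * h p.2) :=
      hkm.stronglyMeasurable.mul (hmeas.comp_measurable measurable_snd)
    exact this.integral_prod_right'
  have hpt : ∀ t, ‖∫ s in Iio t, kernel m (t - s) z * h s‖ₑ ≤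
      ‖∫ s, kernel m (t - s) z * h s‖ₑ + ∫⁻ s, κ (t - s) * ‖h s‖ₑ := by
    intro t
    have hb : ∀ s, 0 ≤ (t - s) * z → ‖kernel m (t - s) z * h s‖ₑ ≤ κ (t - s) * ‖h s‖ₑ := by
      intro s hs
      rw [enorm_mul]
      gcongr
      rw [← ofReal_norm]
      exact ENNReal.ofReal_le_ofReal (hC m _ z hm hs)
    -- The majorant requires (t - s)z ≥ 0. This holds on s < t when z ≥ 0, and on s ≥ t when z ≤ 0;
    -- in the latter case the retarded integral is the full one minus the advanced one.
    rcases le_total 0 z with hz | hz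
    · refine le_add_left ((enorm_integral_le_lintegral_enorm _).trans ?_)
      refine (setLIntegral_mono' measurableSet_Iio fun s hs => hb s ?_).trans
        (setLIntegral_le_lintegral _ _)
      exact mul_nonneg (sub_nonneg.2 (le_of_lt hs)) hz
    · rw [eq_sub_of_add_eq (integral_add_compl (s := Iio t) measurableSet_Iio (hki t))]
      refine enorm_sub_le.trans (add_le_add_right ?_ _)
      refine (enorm_integral_le_lintegral_enorm _).trans ?_
      refine (setLIntegral_mono' measurableSet_Iio.compl fun s hs => hb s ?_).trans
        (setLIntegral_le_lintegral _ _)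
      exact mul_nonneg_of_nonpos_of_nonpos (sub_nonpos.2 (not_lt.1 hs)) hz
  calc _ ≤ eLpNorm ((fun t => ‖∫ s, kernel m (t - s) z * h s‖ₑ) +
        fun t => ∫⁻ s, κ (t - s) * ‖h s‖ₑ) 2 volume := by
        refine eLpNorm_mono_enorm fun t => ?_
        simpa using hpt t
    _ ≤ eLpNorm (fun t => ‖∫ s, kernel m (t - s) z * h s‖ₑ) 2 volume +
        eLpNorm (fun t => ∫⁻ s, κ (t - s) * ‖h s‖ₑ) 2 volume := by
        refine eLpNorm_add_le ?_ ?_ (by norm_num)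
        · exact hfm.enorm.aestronglyMeasurable
        · have : Measurable (fun p : ℝ × ℝ => κ (p.1 - p.2) * ‖h p.2‖ₑ) := by
            have := hmeas.enorm
            fun_prop
          exact this.lintegral_prod_right'.aestronglyMeasurable
    _ ≤ ENNReal.ofReal (5 / m) * eLpNorm h 2 volume +
        ENNReal.ofReal (C * π / m) * eLpNorm h 2 volume := by
        gcongr
        · rw [eLpNorm_enorm]
          exact eLpNorm_kernel_convolution_le hm z hmeas hh
        · rw [← hκint]
          refine (eLpNorm_two_convolution_le hκm hmeas.enorm).trans_eq ?_
          rw [eLpNorm_enorm]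
    _ = _ := by
        rw [← add_mul, ← ENNReal.ofReal_add (by positivity) (by positivity)]
        congr 1
        change _ = ENNReal.ofReal _ * _
        rw [← ENNReal.ofReal_mul (by positivity)]
        congr 1
        field_simp

end Convolution

/-! ### The splitting ξ = (ξ₁, ξ') -/

section Geometry

variable {d : ℕ}

@[simp]
theorem point_zero (a : ℝ) (b : Transversal d) : point a b 0 = a := rfl

@[simp]
theorem point_succ (a : ℝ) (b : Transversal d) (i : Fin d) : point a b i.succ = b i := rfl

theorem point_transversal (ξ : Space d) : point (ξ 0) (transversal ξ) = ξ := by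
  ext i
  refine Fin.cases ?_ (fun i => ?_) i <;> rfl

theorem inner_point (a c : ℝ) (b e : Transversal d) :
    inner ℝ (point a b) (point c e) = a * c + inner ℝ b e := by
  simp only [PiLp.inner_apply, Fin.sum_univ_succ, point_zero, point_succ]
  simp [mul_comm]

theorem norm_point_sq (a : ℝ) (b : Transversal d) : ‖point a b‖ ^ 2 = a ^ 2 + ‖b‖ ^ 2 := by
  rw [← real_inner_self_eq_norm_sq, inner_point, real_inner_self_eq_norm_sq, ← pow_two a]

theorem continuous_point : Continuous (fun p : ℝ × Transversal d => point p.1 p.2) := by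
  refine (PiLp.continuous_toLp 2 _).comp (continuous_pi fun i => ?_)
  refine Fin.cases ?_ (fun i => ?_) i
  · exact continuous_fst
  · exact (EuclideanSpace.proj (𝕜 := ℝ) i).continuous.comp continuous_snd

theorem continuous_transversal : Continuous (transversal : Space d → Transversal d) := by
  refine (PiLp.continuous_toLp 2 _).comp (continuous_pi fun i => ?_)
  exact (EuclideanSpace.proj (𝕜 := ℝ) i.succ).continuous

variable (d) in
/-- The decomposition `ℝ × ℝᵈ ≃ ℝᵈ⁺¹`. -/
def pointEquiv : ℝ × Transversal d ≃ᵐ Space d where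
  toFun p := point p.1 p.2
  invFun ξ := (ξ 0, transversal ξ)
  left_inv _ := rfl
  right_inv ξ := point_transversal ξ
  measurable_toFun := continuous_point.measurable
  measurable_invFun := by
    refine Measurable.prodMk ?_ continuous_transversal.measurable
    exact (EuclideanSpace.proj (𝕜 := ℝ) (0 : Fin (d + 1))).continuous.measurable

theorem measurePreserving_pointEquiv : MeasurePreserving (pointEquiv d) := by
  have h1 : MeasurePreserving (fun p : ℝ × Transversal d => (p.1, WithLp.ofLp p.2)) :=
    (MeasurePreserving.id volume).prod (PiLp.volume_preserving_ofLp (Fin d))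
  have h2 := (volume_preserving_piFinSuccAbove (fun _ : Fin (d + 1) => ℝ) 0).symm
  have h3 := PiLp.volume_preserving_toLp (Fin (d + 1))
  convert h3.comp (h2.comp h1) using 1
  ext p i
  refine Fin.cases ?_ (fun i => ?_) i <;> rfl

theorem integral_point (f : Space d → ℂ) :
    ∫ ξ, f ξ = ∫ p : ℝ × Transversal d, f (point p.1 p.2) :=
  (measurePreserving_pointEquiv.integral_comp (pointEquiv d).measurableEmbedding f).symm

theorem lintegral_point (f : Space d → ℝ≥0∞) :
    ∫⁻ ξ, f ξ = ∫⁻ p : ℝ × Transversal d, f (point p.1 p.2) :=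
  (measurePreserving_pointEquiv.lintegral_comp_emb (pointEquiv d).measurableEmbedding f).symm

theorem Integrable.point {f : Space d → ℂ} (hf : Integrable f) :
    Integrable (fun p : ℝ × Transversal d => f (point p.1 p.2)) :=
  (measurePreserving_pointEquiv.integrable_comp_emb (pointEquiv d).measurableEmbedding).2 hf

theorem symbol_eq (t : ℝ) (ξ : Space d) :
    Complex.exp (4 * (π : ℂ) ^ 2 * Complex.I * (t : ℂ) * ((‖ξ‖ ^ 2 : ℝ) : ℂ)) =
      𝐞 (2 * π * t * ‖ξ‖ ^ 2) := by
  rw [fourierChar_apply]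
  congr 1
  push_cast
  ring

theorem propagator_apply (t : ℝ) (g : Space d → ℂ) (x : Space d) :
    propagator t g x = ∫ ξ, 𝐞 (inner ℝ ξ x + 2 * π * t * ‖ξ‖ ^ 2) • 𝓕 g ξ := by
  unfold propagator multiplier
  rw [Real.fourierInv_eq]
  congr 1 with ξ
  dsimp only
  rw [symbol_eq, AddChar.map_add_eq_mul, mul_smul, Circle.smul_def (𝐞 (2 * π * t * ‖ξ‖ ^ 2)),
    smul_eq_mul]

end Geometry

/-! ### Partial Fourier transform in x' -/

section Slices

variable {α : Type*} [MeasurableSpace α] {d : ℕ}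

theorem stronglyMeasurable_char_smul {f : α → ℂ} (hf : StronglyMeasurable f) {θ : α → ℝ}
    (hθ : Measurable θ) : StronglyMeasurable (fun x => 𝐞 (θ x) • f x) := by
  have : Continuous (fun x : ℝ => (𝐞 x : ℂ)) := by fun_prop
  exact (this.stronglyMeasurable.comp_measurable hθ).mul hf

theorem stronglyMeasurable_comp₂ {β γ : Type*} [MeasurableSpace β] [MeasurableSpace γ]
    {G : β → γ → ℂ} (hG : StronglyMeasurable (fun p : β × γ => G p.1 p.2)) {u : α → β} {v : α → γ}
    (hu : Measurable u) (hv : Measurable v) : StronglyMeasurable (fun x => G (u x) (v x)) :=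
  hG.comp_measurable (hu.prodMk hv)

theorem stronglyMeasurable_fourier {V : Type*} [NormedAddCommGroup V] [InnerProductSpace ℝ V]
    [FiniteDimensional ℝ V] [MeasurableSpace V] [BorelSpace V] {f : α → V → ℂ}
    (hf : StronglyMeasurable (Function.uncurry f)) :
    StronglyMeasurable (fun p : α × V => 𝓕 (f p.1) p.2) := by
  simp_rw [Real.fourier_eq]
  have : StronglyMeasurable (fun q : (α × V) × V => 𝐞 (-inner ℝ q.2 q.1.2) • f q.1.1 q.2) :=
    stronglyMeasurable_char_smul
      (hf.comp_measurable ((measurable_fst.comp measurable_fst).prodMk measurable_snd))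
      (by fun_prop)
  exact this.integral_prod_right'

theorem stronglyMeasurable_fourierInv {V : Type*} [NormedAddCommGroup V] [InnerProductSpace ℝ V]
    [FiniteDimensional ℝ V] [MeasurableSpace V] [BorelSpace V] {f : α → V → ℂ}
    (hf : StronglyMeasurable (Function.uncurry f)) :
    StronglyMeasurable (fun p : α × V => 𝓕⁻ (f p.1) p.2) := by
  simp_rw [Real.fourierInv_eq]
  have : StronglyMeasurable (fun q : (α × V) × V => 𝐞 (inner ℝ q.2 q.1.2) • f q.1.1 q.2) :=
    stronglyMeasurable_char_smul
      (hf.comp_measurable ((measurable_fst.comp measurable_fst).prodMk measurable_snd))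
      (by fun_prop)
  exact this.integral_prod_right'

theorem mixed_sq {γ : Set ℝ} (u : ℝ → Transversal d → ℂ) :
    eLpNorm (fun x' => eLpNorm (fun t => u t x') 2 (volume.restrict γ)) 2 volume ^ 2 =
      ∫⁻ x', ∫⁻ t in γ, ‖u t x'‖ₑ ^ 2 := by
  simp_rw [eLpNorm_two_sq, enorm_eq_self, eLpNorm_two_sq]

/-- Plancherel in the transversal variable for the mixed norm. -/
theorem mixed_fourierInv_sq_le (γ : Set ℝ) {V : ℝ → Transversal d → ℂ}
    (hV : StronglyMeasurable (Function.uncurry V)) (hVi : ∀ t, Integrable (V t)) :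
    eLpNorm (fun x' => eLpNorm (fun t => 𝓕⁻ (V t) x') 2 (volume.restrict γ)) 2 volume ^ 2 ≤
      ∫⁻ ξ', ∫⁻ t, ‖V t ξ'‖ₑ ^ 2 := by
  have hm := stronglyMeasurable_fourierInv hV
  rw [mixed_sq]
  calc ∫⁻ x', ∫⁻ t in γ, ‖𝓕⁻ (V t) x'‖ₑ ^ 2
      ≤ ∫⁻ x', ∫⁻ t, ‖𝓕⁻ (V t) x'‖ₑ ^ 2 :=
        lintegral_mono fun x' => setLIntegral_le_lintegral _ _
    _ = ∫⁻ t, ∫⁻ x', ‖𝓕⁻ (V t) x'‖ₑ ^ 2 := by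
        refine lintegral_lintegral_swap ?_
        exact ((hm.enorm.pow_const 2).comp measurable_swap).aemeasurable
    _ ≤ ∫⁻ t, ∫⁻ ξ', ‖V t ξ'‖ₑ ^ 2 := by
        refine lintegral_mono fun t => ?_
        rw [← eLpNorm_two_sq, ← eLpNorm_two_sq]
        gcongr
        exact eLpNorm_fourierInv_le (hVi t)
    _ = _ := by
        refine lintegral_lintegral_swap ?_
        exact (hV.enorm.pow_const 2).aemeasurable

/-- The partial Fourier transform in the transversal variable. -/
def partialFourier (H : ℝ → Space d → ℂ) (s y : ℝ) (ξ' : Transversal d) : ℂ :=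
  𝓕 (fun y' => H s (point y y')) ξ'

theorem stronglyMeasurable_partialFourier {H : ℝ → Space d → ℂ}
    (hH : StronglyMeasurable (Function.uncurry H)) :
    StronglyMeasurable (fun p : (ℝ × ℝ) × Transversal d => partialFourier H p.1.1 p.1.2 p.2) := by
  refine stronglyMeasurable_fourier (f := fun (p : ℝ × ℝ) y' => H p.1 (point p.2 y')) ?_
  refine hH.comp_measurable ((measurable_fst.comp measurable_fst).prodMk ?_)
  exact continuous_point.measurable.comp
    ((measurable_snd.comp measurable_fst).prodMk measurable_snd)

theorem norm_partialFourier_le (H : ℝ → Space d → ℂ) (s y : ℝ) (ξ' : Transversal d) :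
    ‖partialFourier H s y ξ'‖ ≤ ∫ y', ‖H s (point y y')‖ := by
  unfold partialFourier
  rw [Real.fourier_eq]
  refine (norm_integral_le_integral_norm _).trans_eq ?_
  simp

theorem integrable_slices {H : ℝ → Space d → ℂ} {μ : Measure ℝ} [SFinite μ]
    (hHi : Integrable (Function.uncurry H) (μ.prod volume)) :
    Integrable (fun p : (ℝ × ℝ) × Transversal d => H p.1.1 (point p.1.2 p.2))
      ((μ.prod volume).prod volume) := by
  have h1 := ((MeasurePreserving.id μ).prod (measurePreserving_pointEquiv (d := d)))
  have h2 : Integrable (fun p : ℝ × (ℝ × Transversal d) => H p.1 (point p.2.1 p.2.2))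
      (μ.prod volume) := h1.integrable_comp_of_integrable hHi
  exact (measurePreserving_prodAssoc μ volume volume).integrable_comp_of_integrable h2

/-- The majorant, the L¹ norm in y', does not involve ξ'; hence integrability holds for every ξ',
not just almost every one. -/
theorem integrable_partialFourier {H : ℝ → Space d → ℂ}
    (hH : StronglyMeasurable (Function.uncurry H))
    (hHi : Integrable (Function.uncurry H) (volume.prod volume)) (ξ' : Transversal d) :
    Integrable (fun p : ℝ × ℝ => partialFourier H p.1 p.2 ξ') (volume.prod volume) := by
  refine (integrable_slices hHi).norm.integral_prod_left.mono'
    (((stronglyMeasurable_partialFourier hH).comp_measurable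
      measurable_prodMk_right).aestronglyMeasurable) (.of_forall fun p => ?_)
  exact norm_partialFourier_le H p.1 p.2 ξ'

theorem fourier_point {g : Space d → ℂ} (hg : Integrable g) (a : ℝ) (ξ' : Transversal d) :
    𝓕 g (point a ξ') = ∫ y, 𝐞 (-(y * a)) • 𝓕 (fun y' => g (point y y')) ξ' := by
  rw [Real.fourier_eq, integral_point, Measure.volume_eq_prod, integral_prod]
  · congr 1 with y
    rw [Real.fourier_eq]
    simp_rw [Circle.smul_def, smul_eq_mul, ← integral_const_mul]
    congr 1 with y'
    rw [inner_point, neg_add, AddChar.map_add_eq_mul, Circle.coe_mul, mul_assoc]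
  · exact integrable_char_smul (Integrable.point hg)
      ((continuous_point.inner continuous_const).neg.measurable)

theorem ae_integrable_slice {H : ℝ → Space d → ℂ}
    (hHi : Integrable (Function.uncurry H) (volume.prod volume)) :
    ∀ᵐ y : ℝ, Integrable (fun p : ℝ × Transversal d => H p.1 (point y p.2)) := by
  have e1 : MeasurePreserving (Prod.map Prod.swap id : (ℝ × ℝ) × Transversal d → _)
      ((volume.prod volume).prod volume) ((volume.prod volume).prod volume) :=
    Measure.measurePreserving_swap.prod (MeasurePreserving.id volume)
  have e2 := (measurePreserving_prodAssoc (volume : Measure ℝ) (volume : Measure ℝ)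
    (volume : Measure (Transversal d))).symm
  have h := (e1.comp e2).integrable_comp_of_integrable (integrable_slices hHi)
  exact h.prod_right_ae

/-- Plancherel in the transversal variable for the partial Fourier transform. -/
theorem lintegral_partialFourier_sq_le {γ : Set ℝ} {H : ℝ → Space d → ℂ}
    (hH : StronglyMeasurable (Function.uncurry H)) {y : ℝ}
    (hy : Integrable (fun p : ℝ × Transversal d => H p.1 (point y p.2))) :
    ∫⁻ ξ', ∫⁻ s in γ, ‖partialFourier H s y ξ'‖ₑ ^ 2 ≤
      eLpNorm (fun y' => eLpNorm (fun s => H s (point y y')) 2 (volume.restrict γ)) 2 volume ^ 2 := by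
  rw [mixed_sq (fun s y' => H s (point y y'))]
  have hm := (stronglyMeasurable_partialFourier hH).comp_measurable
    (by fun_prop : Measurable (fun p : Transversal d × ℝ => ((p.2, y), p.1)))
  have hm' : Measurable (fun p : Transversal d × ℝ => H p.2 (point y p.1)) :=
    (hH.comp_measurable (measurable_snd.prodMk (continuous_point.measurable.comp
      (measurable_const.prodMk measurable_fst)))).measurable
  refine (lintegral_lintegral_swap (hm.enorm.pow_const 2).aemeasurable).trans_le
    (le_trans ?_ (lintegral_lintegral_swap (hm'.enorm.pow_const 2).aemeasurable).ge)
  refine lintegral_mono_ae (ae_restrict_of_ae ?_)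
  filter_upwards [hy.prod_right_ae] with s hs
  rw [← eLpNorm_two_sq, ← eLpNorm_two_sq]
  gcongr
  exact eLpNorm_fourier_le hs

theorem integrable_partialFourier_slice {H : ℝ → Space d → ℂ}
    (hH : StronglyMeasurable (Function.uncurry H)) {y : ℝ}
    (hy : Integrable (fun p : ℝ × Transversal d => H p.1 (point y p.2))) (ξ' : Transversal d) :
    Integrable (fun s => partialFourier H s y ξ') := by
  refine hy.norm.integral_prod_left.mono' ?_ (.of_forall fun s => norm_partialFourier_le H s y ξ')
  exact ((stronglyMeasurable_partialFourier hH).comp_measurable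
    (by fun_prop : Measurable (fun s : ℝ => ((s, y), ξ')))).aestronglyMeasurable

end Slices

/-! ### Homogeneous and dual estimates -/

section Smoothing

variable {d : ℕ}

theorem enorm_char_smul (θ : ℝ) (z : ℂ) : ‖𝐞 θ • z‖ₑ = ‖z‖ₑ := by
  rw [← ofReal_norm, Circle.norm_smul, ofReal_norm]

theorem ofReal_sqrt_sq {r : ℝ} (hr : 0 ≤ r) : ENNReal.ofReal √r ^ 2 = ENNReal.ofReal r := by
  rw [← ENNReal.ofReal_pow (sqrt_nonneg r), sq_sqrt hr]

theorem mixedNorm_top_le {γ : Set ℝ} {u : ℝ → Space d → ℂ} {A : ℝ≥0∞}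
    (h : ∀ x₁, eLpNorm (fun x' => eLpNorm (fun t => u t (point x₁ x')) 2 (volume.restrict γ)) 2
      volume ≤ A) : mixedNorm ⊤ γ u ≤ A := by
  unfold mixedNorm
  rw [eLpNorm_exponent_top]
  exact eLpNormEssSup_le_of_ae_enorm_bound (.of_forall h)

theorem mixedNorm_one_eq (γ : Set ℝ) (u : ℝ → Space d → ℂ) :
    mixedNorm 1 γ u = ∫⁻ x₁, eLpNorm (fun x' => eLpNorm (fun t => u t (point x₁ x')) 2
      (volume.restrict γ)) 2 volume := by
  unfold mixedNorm
  rw [eLpNorm_one_eq_lintegral_enorm]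
  rfl

/-- The local smoothing estimate for the free propagator. -/
theorem mixedNorm_propagator_le {l : ℝ} (hl : 0 < l) {g : Space d → ℂ} (hg : Integrable g)
    (hgi : Integrable (𝓕 g)) (hsupp : ∀ ξ, ξ 0 < l → 𝓕 g ξ = 0) (γ : Set ℝ) :
    mixedNorm ⊤ γ (fun t => propagator t g) ≤ ENNReal.ofReal √l⁻¹ * eLpNorm g 2 volume := by
  refine mixedNorm_top_le fun x₁ => ?_
  have hgc : Continuous (𝓕 g) := continuous_fourier hg
  have hgp : Continuous (fun p : ℝ × Transversal d => 𝓕 g (point p.1 p.2)) :=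
    hgc.comp continuous_point
  set V : ℝ → Transversal d → ℂ := fun t ξ' =>
    ∫ a, 𝐞 (a * x₁ + 2 * π * t * (a ^ 2 + ‖ξ'‖ ^ 2)) • 𝓕 g (point a ξ') with hV
  have hVm : StronglyMeasurable (Function.uncurry V) := by
    have : StronglyMeasurable (fun q : (ℝ × Transversal d) × ℝ =>
        𝐞 (q.2 * x₁ + 2 * π * q.1.1 * (q.2 ^ 2 + ‖q.1.2‖ ^ 2)) • 𝓕 g (point q.2 q.1.2)) :=
      stronglyMeasurable_char_smul (hgp.comp (by fun_prop : Continuous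
        fun q : (ℝ × Transversal d) × ℝ => (q.2, q.1.2))).stronglyMeasurable (by fun_prop)
    exact this.integral_prod_right'
  have hVi : ∀ t, Integrable (V t) := fun t => by
    have h1 := integrable_char_smul (Integrable.point hgi)
      (θ := fun p : ℝ × Transversal d => p.1 * x₁ + 2 * π * t * (p.1 ^ 2 + ‖p.2‖ ^ 2))
      (by fun_prop)
    exact h1.integral_prod_right
  have hu : ∀ t x', propagator t g (point x₁ x') = 𝓕⁻ (V t) x' := fun t x' => by
    rw [propagator_apply, integral_point, Measure.volume_eq_prod, integral_prod_symm]
    · rw [Real.fourierInv_eq]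
      congr 1 with ξ'
      simp_rw [hV, Circle.smul_def, smul_eq_mul, ← integral_const_mul]
      congr 1 with a
      rw [inner_point, norm_point_sq, ← mul_assoc, ← Circle.coe_mul, ← AddChar.map_add_eq_mul]
      congr 3
      ring
    · refine integrable_char_smul (Integrable.point hgi) (Continuous.measurable ?_)
      exact (continuous_point.inner continuous_const).add
        (continuous_const.mul (continuous_point.norm.pow 2))
  simp_rw [hu]
  refine le_of_sq_le_sq ((mixed_fourierInv_sq_le γ hVm hVi).trans ?_)
  rw [mul_pow, ofReal_sqrt_sq (by positivity)]
  have hae : ∀ᵐ ξ' : Transversal d, Integrable (fun a => 𝓕 g (point a ξ')) :=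
    (Integrable.point hgi).prod_left_ae
  calc ∫⁻ ξ', ∫⁻ t, ‖V t ξ'‖ₑ ^ 2
      ≤ ∫⁻ ξ', ENNReal.ofReal l⁻¹ * ∫⁻ a, ‖𝓕 g (point a ξ')‖ₑ ^ 2 := by
        refine lintegral_mono_ae ?_
        filter_upwards [hae] with ξ' hξ'
        rw [← eLpNorm_two_sq]
        -- Up to the unimodular factor e(2πt|ξ'|²), which does not depend on `a`, `V t ξ'` is the
        -- extension of a ↦ e(a x₁) ĝ(a, ξ').
        have h1 := eLpNorm_extension_sq_le hl (integrable_char_smul hξ'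
          (θ := fun a => a * x₁) (by fun_prop)) (fun a ha => by
            rw [hsupp (point a ξ') ha, smul_zero])
        refine le_trans (le_of_eq ?_) (h1.trans_eq ?_)
        · congr 1
          refine eLpNorm_congr_norm_ae (.of_forall fun t => ?_)
          have : V t ξ' = 𝐞 (2 * π * t * ‖ξ'‖ ^ 2) •
              ∫ a, 𝐞 (2 * π * t * a ^ 2) • 𝐞 (a * x₁) • 𝓕 g (point a ξ') := by
            simp_rw [hV, Circle.smul_def, smul_eq_mul, ← integral_const_mul]
            congr 1 with a
            rw [← mul_assoc, ← mul_assoc, ← Circle.coe_mul, ← Circle.coe_mul,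
              ← AddChar.map_add_eq_mul, ← AddChar.map_add_eq_mul]
            congr 3
            ring
          rw [this, Circle.norm_smul]
        · simp_rw [eLpNorm_two_sq, enorm_char_smul]
    _ = ENNReal.ofReal l⁻¹ * eLpNorm (𝓕 g) 2 volume ^ 2 := by
        rw [lintegral_const_mul' _ _ ENNReal.ofReal_ne_top, eLpNorm_two_sq, lintegral_point,
          Measure.volume_eq_prod, lintegral_prod_symm _ (by
            exact (hgp.measurable.enorm.pow_const 2).aemeasurable)]
    _ ≤ _ := by
        gcongr
        exact eLpNorm_fourier_le hg

/-- A space-time function all of whose spatial Fourier transforms are localized at frequencies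
`ξ` with `ξ₁ ∼ |ξ| ∼ m`. -/
structure IsLocalized (m : ℝ) (H : ℝ → Space d → ℂ) : Prop where
  stronglyMeasurable : StronglyMeasurable (Function.uncurry H)
  integrable : Integrable (Function.uncurry H) (volume.prod volume)
  support : ∀ s ξ, 𝓕 (H s) ξ ≠ 0 → 2 / 5 * m ≤ ξ 0 ∧ ξ 0 ≤ 2 * m ∧ ‖ξ‖ ≤ 2 * m

namespace IsLocalized

variable {m : ℝ} {H : ℝ → Space d → ℂ}

theorem stronglyMeasurable_fourier (hH : IsLocalized m H) :
    StronglyMeasurable (fun p : ℝ × Space d => 𝓕 (H p.1) p.2) :=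
  ConeSmoothing.stronglyMeasurable_fourier hH.stronglyMeasurable

/-- Bounded frequency support is decisive: the transform is dominated by the L¹ norm of `H s` times
the indicator of a ball. This justifies the later uses of Fubini. -/
theorem integrable_fourier (hH : IsLocalized m H) :
    Integrable (fun p : ℝ × Space d => 𝓕 (H p.1) p.2) (volume.prod volume) := by
  have hb : Integrable ((Metric.closedBall (0 : Space d) (2 * m)).indicator fun _ => (1 : ℝ)) :=
    (integrable_indicator_iff measurableSet_closedBall).2
      (integrableOn_const measure_closedBall_lt_top.ne)
  refine (hH.integrable.norm.integral_prod_left.mul_prod hb).mono'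
    hH.stronglyMeasurable_fourier.aestronglyMeasurable (.of_forall fun p => ?_)
  by_cases h : 𝓕 (H p.1) p.2 = 0
  · rw [h, norm_zero]
    exact mul_nonneg (integral_nonneg fun _ => norm_nonneg _)
      (indicator_nonneg (fun _ _ => zero_le_one) _)
  · rw [indicator_of_mem (by simpa using (hH.support _ _ h).2.2), mul_one, Real.fourier_eq]
    exact (norm_integral_le_integral_norm _).trans_eq (by simp)

theorem integrable_fourier_restrict (hH : IsLocalized m H) (γ : Set ℝ) :
    Integrable (fun p : ℝ × Space d => 𝓕 (H p.1) p.2) ((volume.restrict γ).prod volume) := by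
  have := Measure.prod_restrict (μ := (volume : Measure ℝ)) (ν := (volume : Measure (Space d)))
    γ univ
  rw [Measure.restrict_univ] at this
  rw [this]
  exact hH.integrable_fourier.restrict

theorem integrable_partialFourier_restrict (hH : IsLocalized m H) (γ : Set ℝ)
    (ξ' : Transversal d) : Integrable (fun p : ℝ × ℝ => partialFourier H p.1 p.2 ξ')
      ((volume.restrict γ).prod volume) := by
  have := Measure.prod_restrict (μ := (volume : Measure ℝ)) (ν := (volume : Measure ℝ)) γ univ
  rw [Measure.restrict_univ] at this
  rw [this]
  exact (integrable_partialFourier hH.stronglyMeasurable hH.integrable ξ').restrict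

theorem ae_fourier_point (hH : IsLocalized m H) : ∀ᵐ s : ℝ, ∀ (a : ℝ) (ξ' : Transversal d),
    𝓕 (H s) (point a ξ') = ∫ y, 𝐞 (-(y * a)) • partialFourier H s y ξ' := by
  filter_upwards [hH.integrable.prod_right_ae] with s hs a ξ'
  exact fourier_point hs a ξ'

/-- The dual local smoothing estimate. -/
theorem eLpNorm_timeIntegral_le (hm : 0 < m) (hH : IsLocalized m H) {γ : Set ℝ}
    (hγ : MeasurableSet γ) :
    eLpNorm (timeIntegral γ H) 2 volume ≤
      ENNReal.ofReal √(2 / 5 * m)⁻¹ * mixedNorm 1 γ H := by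
  set l := 2 / 5 * m with hlm
  have hl : 0 < l := by positivity
  have hGi := hH.integrable_fourier_restrict γ
  set M : Space d → ℂ := fun ξ => ∫ t in γ, 𝐞 (2 * π * t * ‖ξ‖ ^ 2) • 𝓕 (H t) ξ with hM
  have hMi : Integrable M := by
    have h1 := integrable_char_smul hGi
      (θ := fun p : ℝ × Space d => 2 * π * p.1 * ‖p.2‖ ^ 2) (by fun_prop)
    exact h1.integral_prod_right
  have hT : timeIntegral γ H = 𝓕⁻ M := by
    ext x
    unfold timeIntegral
    simp_rw [propagator_apply]
    rw [integral_integral_swap, Real.fourierInv_eq]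
    · congr 1 with ξ
      simp_rw [hM, AddChar.map_add_eq_mul, Circle.smul_def, Circle.coe_mul, smul_eq_mul,
        ← integral_const_mul, mul_assoc]
    · exact integrable_char_smul hGi (by fun_prop)
  rw [hT]
  refine (eLpNorm_fourierInv_le hMi).trans ?_
  -- The phase in ξ' and the truncation to γ are absorbed into `h`, leaving a one-dimensional
  -- restriction for each y and ξ'.
  set h : ℝ → Transversal d → ℝ → ℂ := fun y ξ' => γ.indicator
    (fun t => 𝐞 (2 * π * t * ‖ξ'‖ ^ 2) • partialFourier H t y ξ') with hh
  set f : ℝ × Transversal d → ℝ → ℝ≥0∞ := fun p y =>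
    ‖∫ t, 𝐞 (2 * π * t * p.1 ^ 2) • h y p.2 t‖ₑ with hf
  have hfm : Measurable (Function.uncurry f) := by
    have h1 : StronglyMeasurable (fun q : ((ℝ × Transversal d) × ℝ) × ℝ =>
        𝐞 (2 * π * q.2 * ‖q.1.1.2‖ ^ 2) • partialFourier H q.2 q.1.2 q.1.1.2) :=
      stronglyMeasurable_char_smul ((stronglyMeasurable_partialFourier
        hH.stronglyMeasurable).comp_measurable (by fun_prop : Measurable
          (fun q : ((ℝ × Transversal d) × ℝ) × ℝ => ((q.2, q.1.2), q.1.1.2)))) (by fun_prop)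
    have h2 := h1.indicator (measurable_snd hγ)
    have h3 : StronglyMeasurable (fun q : ((ℝ × Transversal d) × ℝ) × ℝ =>
        𝐞 (2 * π * q.2 * q.1.1.1 ^ 2) • h q.1.2 q.1.1.2 q.2) :=
      stronglyMeasurable_char_smul h2 (by fun_prop)
    exact h3.integral_prod_right'.enorm
  have hMf : ∀ a ξ', ‖M (point a ξ')‖ₑ ≤ ∫⁻ y, f (a, ξ') y := by
    intro a ξ'
    have h1 : M (point a ξ') = ∫ y, 𝐞 (-(y * a)) • ∫ t, 𝐞 (2 * π * t * a ^ 2) • h y ξ' t := by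
      have h2 : M (point a ξ') = ∫ t in γ, ∫ y, 𝐞 (2 * π * t * (a ^ 2 + ‖ξ'‖ ^ 2) - y * a) •
          partialFourier H t y ξ' := by
        refine integral_congr_ae (ae_restrict_of_ae ?_)
        filter_upwards [hH.ae_fourier_point] with t ht
        rw [ht, norm_point_sq]
        simp_rw [sub_eq_add_neg, AddChar.map_add_eq_mul, Circle.smul_def, Circle.coe_mul,
          smul_eq_mul, ← integral_const_mul, mul_assoc]
      rw [h2, integral_integral_swap]
      · congr 1 with y
        rw [← integral_indicator hγ]
        simp_rw [Circle.smul_def, smul_eq_mul, ← integral_const_mul]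
        congr 1 with t
        by_cases ht : t ∈ γ
        · simp only [hh, indicator_of_mem ht, Circle.smul_def, smul_eq_mul]
          rw [← mul_assoc, ← mul_assoc, ← Circle.coe_mul, ← Circle.coe_mul,
            ← AddChar.map_add_eq_mul, ← AddChar.map_add_eq_mul]
          congr 3
          ring
        · simp [hh, indicator_of_notMem ht]
      · exact integrable_char_smul (hH.integrable_partialFourier_restrict γ ξ') (by fun_prop)
    rw [h1]
    refine (enorm_integral_le_lintegral_enorm _).trans_eq (lintegral_congr fun y => ?_)
    rw [enorm_char_smul]
  have hMs : ∀ a ξ', a < l → M (point a ξ') = 0 := fun a ξ' ha => by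
    have : ∀ t, 𝓕 (H t) (point a ξ') = 0 := fun t => by
      by_contra h
      exact absurd (hH.support _ _ h).1 (not_le.2 ha)
    simp [hM, this]
  calc eLpNorm M 2 volume
      ≤ eLpNorm (fun p => ∫⁻ y, f p y) 2 ((volume.restrict (Ici l)).prod volume) := by
        refine le_of_sq_le_sq ?_
        have hr := Measure.prod_restrict (μ := (volume : Measure ℝ))
          (ν := (volume : Measure (Transversal d))) (Ici l) univ
        rw [Measure.restrict_univ] at hr
        rw [eLpNorm_two_sq, eLpNorm_two_sq, lintegral_point, hr,
          ← lintegral_indicator (measurableSet_Ici.prod MeasurableSet.univ),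
          Measure.volume_eq_prod]
        refine lintegral_mono fun p => ?_
        by_cases hp : p ∈ Ici l ×ˢ univ
        · rw [indicator_of_mem hp, enorm_eq_self]
          gcongr
          exact hMf p.1 p.2
        · rw [hMs p.1 p.2 (by simpa using hp)]
          simp
    _ ≤ ∫⁻ y, eLpNorm (fun p => f p y) 2 ((volume.restrict (Ici l)).prod volume) :=
        eLpNorm_two_lintegral_le hfm
    _ ≤ ∫⁻ y, ENNReal.ofReal √l⁻¹ * eLpNorm (fun x' => eLpNorm (fun t => H t (point y x')) 2
          (volume.restrict γ)) 2 volume := by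
        refine lintegral_mono_ae ?_
        filter_upwards [ae_integrable_slice hH.integrable] with y hy
        refine le_of_sq_le_sq ?_
        rw [mul_pow, ofReal_sqrt_sq (by positivity), eLpNorm_two_sq]
        refine le_trans ?_ (mul_le_mul_right (lintegral_partialFourier_sq_le (γ := γ)
          hH.stronglyMeasurable hy) _)
        have hfy : Measurable (fun p => f p y) := hfm.of_uncurry_right
        rw [lintegral_prod_symm _ (hfy.enorm.pow_const 2).aemeasurable,
          ← lintegral_const_mul' _ _ ENNReal.ofReal_ne_top]
        refine lintegral_mono fun ξ' => ?_
        have hhi : Integrable (h y ξ') := (integrable_char_smul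
          (integrable_partialFourier_slice hH.stronglyMeasurable hy ξ') (by fun_prop)).indicator hγ
        refine (lintegral_restriction_le hl hhi).trans_eq ?_
        rw [eLpNorm_two_sq, ← lintegral_indicator hγ]
        congr 1
        refine lintegral_congr fun t => ?_
        by_cases ht : t ∈ γ
        · simp only [hh, indicator_of_mem ht, enorm_char_smul]
        · simp [hh, indicator_of_notMem ht]
    _ = _ := by
        rw [lintegral_const_mul' _ _ ENNReal.ofReal_ne_top, mixedNorm_one_eq]

end IsLocalized

end Smoothing

/-! ### The retarded estimate -/

section Duhamel

variable {d : ℕ}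

theorem integral_slices {μ : Measure ℝ} [SFinite μ] (f : ℝ × Space d → ℂ) :
    ∫ z, f z ∂(μ.prod volume) =
      ∫ q : (ℝ × ℝ) × Transversal d, f (q.1.1, point q.1.2 q.2) ∂((μ.prod volume).prod volume) := by
  have h1 : MeasurePreserving ((MeasurableEquiv.refl ℝ).prodCongr (pointEquiv d))
      (μ.prod (volume.prod volume)) (μ.prod volume) :=
    (MeasurePreserving.id μ).prod (measurePreserving_pointEquiv (d := d))
  have h2 := measurePreserving_prodAssoc μ (volume : Measure ℝ) (volume : Measure (Transversal d))
  rw [← h1.integral_comp', ← h2.integral_comp']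
  rfl

/-- The cutoff equals 1 wherever `g` is nonzero, so inserting it changes nothing; it makes the
double integral in (a, y) absolutely convergent, and the a-integral taken first is the kernel. -/
theorem integral_char_smul_eq_kernel {m : ℝ} (hm : m ≠ 0) {g w : ℝ → ℂ} (hw : Integrable w)
    (hg : ∀ a, g a = ∫ y, 𝐞 (-(y * a)) • w y) (hs : ∀ a, g a ≠ 0 → bump (a / m) = 1) (τ x : ℝ) :
    ∫ a, 𝐞 (a * x + 2 * π * τ * a ^ 2) • g a = ∫ y, kernel m τ (x - y) * w y := by
  have h1 : ∀ a, 𝐞 (a * x + 2 * π * τ * a ^ 2) • g a =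
      ∫ y, 𝐞 (a * (x - y) + 2 * π * τ * a ^ 2) • ((bump (a / m) : ℂ) * w y) := fun a => by
    have : g a = (bump (a / m) : ℂ) * g a := by
      by_cases h : g a = 0
      · rw [h, mul_zero]
      · rw [hs a h, Complex.ofReal_one, one_mul]
    rw [this, hg]
    simp_rw [Circle.smul_def, smul_eq_mul, ← integral_const_mul]
    congr 1 with y
    have : 𝐞 (a * (x - y) + 2 * π * τ * a ^ 2) = 𝐞 (a * x + 2 * π * τ * a ^ 2) * 𝐞 (-(y * a)) := by
      rw [← AddChar.map_add_eq_mul]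
      congr 1; ring
    rw [this, Circle.coe_mul]
    ring
  simp_rw [h1]
  have hbm : Integrable (fun a : ℝ => (bump (a / m) : ℂ)) := (integrable_bump.comp_div hm).ofReal
  rw [integral_integral_swap]
  · congr 1 with y
    unfold kernel
    rw [← integral_mul_const]
    simp_rw [Circle.smul_def, smul_eq_mul, mul_assoc]
  · exact integrable_char_smul (hbm.mul_prod hw)
      (θ := fun p : ℝ × ℝ => p.1 * (x - p.2) + 2 * π * τ * p.1 ^ 2) (by fun_prop)

namespace IsLocalized

variable {m : ℝ} {H : ℝ → Space d → ℂ}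

/-- The partial Fourier transform in the transversal variable of the Duhamel integral. -/
def duhamelSlice (H : ℝ → Space d → ℂ) (x₁ t : ℝ) (ξ' : Transversal d) : ℂ :=
  ∫ p : ℝ × ℝ, 𝐞 (p.2 * x₁ + 2 * π * (t - p.1) * (p.2 ^ 2 + ‖ξ'‖ ^ 2)) •
    𝓕 (H p.1) (point p.2 ξ') ∂((volume.restrict (Iio t)).prod volume)

theorem stronglyMeasurable_fourier_point (hH : IsLocalized m H) :
    StronglyMeasurable (fun q : (ℝ × ℝ) × Transversal d => 𝓕 (H q.1.1) (point q.1.2 q.2)) := by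
  refine stronglyMeasurable_comp₂ (G := fun s ξ => 𝓕 (H s) ξ) hH.stronglyMeasurable_fourier
    (measurable_fst.comp measurable_fst) ?_
  exact continuous_point.measurable.comp
    ((measurable_snd.comp measurable_fst).prodMk measurable_snd)

theorem stronglyMeasurable_duhamelSlice (hH : IsLocalized m H) (x₁ : ℝ) :
    StronglyMeasurable (Function.uncurry (duhamelSlice H x₁)) := by
  have h1 : StronglyMeasurable (fun q : (ℝ × Transversal d) × (ℝ × ℝ) =>
      𝐞 (q.2.2 * x₁ + 2 * π * (q.1.1 - q.2.1) * (q.2.2 ^ 2 + ‖q.1.2‖ ^ 2)) •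
        𝓕 (H q.2.1) (point q.2.2 q.1.2)) :=
    stronglyMeasurable_char_smul (hH.stronglyMeasurable_fourier_point.comp_measurable
      (by fun_prop : Measurable (fun q : (ℝ × Transversal d) × (ℝ × ℝ) => (q.2, q.1.2))))
      (by fun_prop)
  -- The domain s < t moves with t, so measurability is obtained from an indicator on the joint
  -- space.
  have hs : MeasurableSet {q : (ℝ × Transversal d) × (ℝ × ℝ) | q.2.1 < q.1.1} :=
    measurableSet_lt (by fun_prop) (by fun_prop)
  have h2 := (h1.indicator hs).integral_prod_right' (ν := volume.prod volume)
  convert h2 using 1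
  ext ⟨t, ξ'⟩
  have hr := Measure.prod_restrict (μ := (volume : Measure ℝ)) (ν := (volume : Measure ℝ))
    (Iio t) univ
  rw [Measure.restrict_univ] at hr
  simp only [Function.uncurry, duhamelSlice]
  rw [hr, ← integral_indicator (measurableSet_Iio.prod MeasurableSet.univ)]
  congr 1 with p
  by_cases hp : p.1 < t
  · rw [indicator_of_mem (by simpa using hp), indicator_of_mem (by simpa using hp)]
  · rw [indicator_of_notMem (by simpa using hp), indicator_of_notMem (by simpa using hp)]

theorem integrable_duhamelSlice (hH : IsLocalized m H) (x₁ t : ℝ) :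
    Integrable (duhamelSlice H x₁ t) := by
  have h1 := integrable_slices (H := fun s ξ => 𝓕 (H s) ξ) (hH.integrable_fourier_restrict (Iio t))
  have h2 := integrable_char_smul h1 (θ := fun q : (ℝ × ℝ) × Transversal d =>
    q.1.2 * x₁ + 2 * π * (t - q.1.1) * (q.1.2 ^ 2 + ‖q.2‖ ^ 2)) (by fun_prop)
  exact h2.integral_prod_right

theorem duhamel_eq_fourierInv (hH : IsLocalized m H) (t x₁ : ℝ) (x' : Transversal d) :
    duhamel H t (point x₁ x') = 𝓕⁻ (duhamelSlice H x₁ t) x' := by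
  have h1 : Integrable (fun z : ℝ × Space d =>
      𝐞 (inner ℝ z.2 (point x₁ x') + 2 * π * (t - z.1) * ‖z.2‖ ^ 2) • 𝓕 (H z.1) z.2)
      ((volume.restrict (Iio t)).prod volume) :=
    integrable_char_smul (hH.integrable_fourier_restrict (Iio t)) (by fun_prop)
  have h2 := integrable_slices (H := fun s ξ =>
      𝐞 (inner ℝ ξ (point x₁ x') + 2 * π * (t - s) * ‖ξ‖ ^ 2) • 𝓕 (H s) ξ) h1
  unfold duhamel
  simp_rw [propagator_apply]
  rw [← integral_prod _ h1, integral_slices, integral_prod_symm _ h2, Real.fourierInv_eq]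
  congr 1 with ξ'
  unfold duhamelSlice
  simp_rw [Circle.smul_def, smul_eq_mul, ← integral_const_mul]
  congr 1 with p
  rw [inner_point, norm_point_sq, ← mul_assoc, ← Circle.coe_mul, ← AddChar.map_add_eq_mul]
  congr 3
  ring

theorem ae_integrable_fourier_point (hH : IsLocalized m H) :
    ∀ᵐ ξ' : Transversal d, Integrable (fun p : ℝ × ℝ => 𝓕 (H p.1) (point p.2 ξ'))
      (volume.prod volume) :=
  (integrable_slices (H := fun s ξ => 𝓕 (H s) ξ) hH.integrable_fourier).prod_left_ae

theorem bump_eq_one_of_fourier_ne_zero (hm : 0 < m) (hH : IsLocalized m H) {s a : ℝ}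
    {ξ' : Transversal d} (h : 𝓕 (H s) (point a ξ') ≠ 0) : bump (a / m) = 1 := by
  obtain ⟨h1, h2, -⟩ := hH.support s _ h
  rw [point_zero] at h1 h2
  exact bump_eq_one ((le_div_iff₀ hm).2 h1) ((div_le_iff₀ hm).2 h2)

/-- The phase e(2π(t - s)|ξ'|²) factors: the part in t leaves the s-integral and is invisible to
norms, the part in s only modulates the source. -/
theorem duhamelSlice_eq (hm : 0 < m) (hH : IsLocalized m H) (x₁ t : ℝ) {ξ' : Transversal d}
    (hξ : Integrable (fun p : ℝ × ℝ => 𝓕 (H p.1) (point p.2 ξ')) (volume.prod volume)) :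
    duhamelSlice H x₁ t ξ' = ∫ y, 𝐞 (2 * π * t * ‖ξ'‖ ^ 2) • ∫ s in Iio t,
      kernel m (t - s) (x₁ - y) * 𝐞 (-(2 * π * s * ‖ξ'‖ ^ 2)) • partialFourier H s y ξ' := by
  have hr := Measure.prod_restrict (μ := (volume : Measure ℝ)) (ν := (volume : Measure ℝ))
    (Iio t) univ
  rw [Measure.restrict_univ] at hr
  have hξ' : Integrable (fun p : ℝ × ℝ => 𝓕 (H p.1) (point p.2 ξ'))
      ((volume.restrict (Iio t)).prod volume) := by
    rw [hr]; exact hξ.restrict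
  have hw := integrable_partialFourier hH.stronglyMeasurable hH.integrable ξ'
  have hk : Continuous (fun p : ℝ × ℝ => kernel m (t - p.1) (x₁ - p.2)) :=
    continuous_kernel_comp hm.ne' (by fun_prop) (by fun_prop)
  unfold duhamelSlice
  rw [integral_prod _ (integrable_char_smul hξ' (by fun_prop))]
  have h1 : ∀ᵐ s ∂(volume.restrict (Iio t)),
      ∫ a, 𝐞 (a * x₁ + 2 * π * (t - s) * (a ^ 2 + ‖ξ'‖ ^ 2)) • 𝓕 (H s) (point a ξ') =
      ∫ y, kernel m (t - s) (x₁ - y) *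
        𝐞 (2 * π * (t - s) * ‖ξ'‖ ^ 2) • partialFourier H s y ξ' := by
    refine ae_restrict_of_ae ?_
    filter_upwards [hH.ae_fourier_point, hw.prod_right_ae] with s hs hws
    have h2 := integral_char_smul_eq_kernel hm.ne' hws (fun a => hs a ξ')
      (fun a ha => bump_eq_one_of_fourier_ne_zero hm hH ha) (t - s) x₁
    have h3 : ∀ a, 𝐞 (a * x₁ + 2 * π * (t - s) * (a ^ 2 + ‖ξ'‖ ^ 2)) =
        𝐞 (2 * π * (t - s) * ‖ξ'‖ ^ 2) * 𝐞 (a * x₁ + 2 * π * (t - s) * a ^ 2) := fun a => by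
      rw [← AddChar.map_add_eq_mul]
      congr 1; ring
    simp_rw [h3, mul_smul, Circle.smul_def (𝐞 (2 * π * (t - s) * ‖ξ'‖ ^ 2)), integral_smul, h2]
    rw [← integral_smul]
    congr 1 with y
    simp only [smul_eq_mul]
    ring
  rw [integral_congr_ae h1, integral_integral_swap]
  · congr 1 with y
    rw [Circle.smul_def, ← integral_smul]
    congr 1 with s
    have h3 : 𝐞 (2 * π * (t - s) * ‖ξ'‖ ^ 2) =
        𝐞 (2 * π * t * ‖ξ'‖ ^ 2) * 𝐞 (-(2 * π * s * ‖ξ'‖ ^ 2)) := by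
      rw [← AddChar.map_add_eq_mul]
      congr 1; ring
    rw [h3, mul_smul]
    simp only [Circle.smul_def, smul_eq_mul]
    ring
  · refine Integrable.bdd_mul (integrable_char_smul
      (hH.integrable_partialFourier_restrict (Iio t) ξ') (by fun_prop)) hk.aestronglyMeasurable
      (.of_forall fun p => norm_kernel_le m _ _)

/-- The retarded estimate, with the constant of the retarded convolution. -/
theorem mixedNorm_duhamel_le {C : ℝ≥0} (hC : ∀ m : ℝ, 0 < m → ∀ z : ℝ,
    ∀ h : ℝ → ℂ, StronglyMeasurable h → Integrable h →
    eLpNorm (fun t => ∫ s in Iio t, kernel m (t - s) z * h s) 2 volume ≤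
      C * ENNReal.ofReal m⁻¹ * eLpNorm h 2 volume) (hm : 0 < m) (hH : IsLocalized m H) :
    mixedNorm ⊤ univ (duhamel H) ≤ C * ENNReal.ofReal m⁻¹ * mixedNorm 1 univ H := by
  refine mixedNorm_top_le fun x₁ => ?_
  simp_rw [hH.duhamel_eq_fourierInv]
  set h : ℝ → Transversal d → ℝ → ℂ := fun y ξ' s =>
    𝐞 (-(2 * π * s * ‖ξ'‖ ^ 2)) • partialFourier H s y ξ' with hh
  set f : ℝ × Transversal d → ℝ → ℝ≥0∞ := fun p y =>
    ‖∫ s in Iio p.1, kernel m (p.1 - s) (x₁ - y) * h y p.2 s‖ₑ with hf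
  have hhm : StronglyMeasurable (fun q : (ℝ × Transversal d) × ℝ => h q.1.1 q.1.2 q.2) :=
    stronglyMeasurable_char_smul ((stronglyMeasurable_partialFourier
      hH.stronglyMeasurable).comp_measurable (by fun_prop : Measurable
        (fun q : (ℝ × Transversal d) × ℝ => ((q.2, q.1.1), q.1.2)))) (by fun_prop)
  have hfm : Measurable (Function.uncurry f) := by
    have hk : Continuous (fun q : ((ℝ × Transversal d) × ℝ) × ℝ =>
        kernel m (q.1.1.1 - q.2) (x₁ - q.1.2)) :=
      continuous_kernel_comp hm.ne' (by fun_prop) (by fun_prop)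
    have h1 : StronglyMeasurable (fun q : ((ℝ × Transversal d) × ℝ) × ℝ =>
        kernel m (q.1.1.1 - q.2) (x₁ - q.1.2) * h q.1.2 q.1.1.2 q.2) :=
      hk.stronglyMeasurable.mul (stronglyMeasurable_comp₂
        (G := fun (r : ℝ × Transversal d) s => h r.1 r.2 s) hhm
        (u := fun q : ((ℝ × Transversal d) × ℝ) × ℝ => (q.1.2, q.1.1.2)) (by fun_prop)
        measurable_snd)
    have hs : MeasurableSet {q : ((ℝ × Transversal d) × ℝ) × ℝ | q.2 < q.1.1.1} :=
      measurableSet_lt (by fun_prop) (by fun_prop)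
    have h2 := ((h1.indicator hs).integral_prod_right' (ν := volume)).enorm
    convert h2 using 1
    ext ⟨⟨t, ξ'⟩, y⟩
    simp only [Function.uncurry, hf]
    rw [← integral_indicator measurableSet_Iio]
    rfl
  have hVf : ∀ᵐ ξ', ∀ t, ‖duhamelSlice H x₁ t ξ'‖ₑ ≤ ∫⁻ y, f (t, ξ') y := by
    filter_upwards [hH.ae_integrable_fourier_point] with ξ' hξ' t
    rw [duhamelSlice_eq hm hH x₁ t hξ']
    refine (enorm_integral_le_lintegral_enorm _).trans_eq (lintegral_congr fun y => ?_)
    rw [enorm_char_smul]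
  have hfm' : Measurable (fun p => ∫⁻ y, f p y) := hfm.lintegral_prod_right'
  have step : eLpNorm (fun x' => eLpNorm (fun t => 𝓕⁻ (duhamelSlice H x₁ t) x') 2
      (volume.restrict univ)) 2 volume ≤
      eLpNorm (fun p => ∫⁻ y, f p y) 2 (volume.prod volume) := by
    refine le_of_sq_le_sq ((mixed_fourierInv_sq_le univ (hH.stronglyMeasurable_duhamelSlice x₁)
      (hH.integrable_duhamelSlice x₁)).trans ?_)
    rw [eLpNorm_two_sq, lintegral_prod_symm _ (hfm'.enorm.pow_const 2).aemeasurable]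
    refine lintegral_mono_ae ?_
    filter_upwards [hVf] with ξ' hξ'
    refine lintegral_mono fun t => ?_
    rw [enorm_eq_self]
    gcongr
    exact hξ' t
  -- Minkowski takes the y-integral outside; for each y there remains a retarded convolution with z
  -- = x₁ - y.
  refine step.trans ((eLpNorm_two_lintegral_le hfm).trans ?_)
  rw [mixedNorm_one_eq, ← lintegral_const_mul' _ _
    (ENNReal.mul_ne_top ENNReal.coe_ne_top ENNReal.ofReal_ne_top)]
  refine lintegral_mono_ae ?_
  filter_upwards [ae_integrable_slice hH.integrable] with y hy
  refine le_of_sq_le_sq ?_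
  rw [mul_pow, eLpNorm_two_sq]
  refine le_trans ?_ (mul_le_mul_right (lintegral_partialFourier_sq_le (γ := univ)
    hH.stronglyMeasurable hy) _)
  have hfy : Measurable (fun p => f p y) := hfm.of_uncurry_right
  rw [lintegral_prod_symm _ (hfy.enorm.pow_const 2).aemeasurable,
    ← lintegral_const_mul' _ _ (ENNReal.pow_ne_top
      (ENNReal.mul_ne_top ENNReal.coe_ne_top ENNReal.ofReal_ne_top))]
  refine lintegral_mono fun ξ' => ?_
  have hhi : Integrable (h y ξ') := integrable_char_smul
    (integrable_partialFourier_slice hH.stronglyMeasurable hy ξ') (by fun_prop)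
  have hhs : StronglyMeasurable (h y ξ') := stronglyMeasurable_comp₂
    (G := fun (r : ℝ × Transversal d) s => h r.1 r.2 s) hhm
    (u := fun _ : ℝ => (y, ξ')) measurable_const measurable_id
  have h1 := pow_le_pow_left₀ zero_le (hC m hm (x₁ - y) _ hhs hhi) 2
  rw [mul_pow, eLpNorm_two_sq, eLpNorm_two_sq] at h1
  simp_rw [hf, enorm_eq_self]
  refine h1.trans_eq ?_
  simp_rw [hh, enorm_char_smul, Measure.restrict_univ]

end IsLocalized

end Duhamel

/-! ### Littlewood–Paley pieces are localized -/

section Projection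

variable {d : ℕ} {χ : ℝ → ℝ}

theorem IsCutoff.annulus_eq_zero (hχ : IsCutoff χ) {ξ : Space d} (h : ‖ξ‖ ≤ 1 / 2 ∨ 2 ≤ ‖ξ‖) :
    annulus χ ξ = 0 := by
  have h0 := norm_nonneg ξ
  unfold annulus
  rcases h with h | h
  · rw [hχ.eq_one _ h0 (by linarith), hχ.eq_one _ (by linarith) (by linarith), sub_self]
  · rw [hχ.eq_zero _ h, hχ.eq_zero _ (by linarith), sub_self]

/-- Near the origin both χ-terms equal 1 and cancel, so the singularity of the norm is harmless. -/
theorem IsCutoff.contDiff_annulus (hχ : IsCutoff χ) : ContDiff ℝ ∞ (annulus χ : Space d → ℝ) := by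
  rw [contDiff_iff_contDiffAt]
  intro ξ
  by_cases h : ξ = 0
  · have : (annulus χ : Space d → ℝ) =ᶠ[nhds ξ] fun _ => 0 := by
      filter_upwards [Metric.ball_mem_nhds ξ (by norm_num : (0 : ℝ) < 1 / 2)] with η hη
      rw [h, mem_ball_zero_iff] at hη
      exact hχ.annulus_eq_zero (.inl hη.le)
    exact contDiffAt_const.congr_of_eventuallyEq this
  · have hp : 0 < ‖ξ‖ := norm_pos_iff.2 h
    have hn : ContDiffAt ℝ ∞ (fun ξ : Space d => ‖ξ‖) ξ := contDiffAt_norm ℝ h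
    have h1 : ContDiffAt ℝ ∞ χ ‖ξ‖ := hχ.smooth.contDiffAt (Ioi_mem_nhds hp)
    have h2 : ContDiffAt ℝ ∞ χ (2 * ‖ξ‖) := hχ.smooth.contDiffAt (Ioi_mem_nhds (by positivity))
    exact (h1.comp ξ hn).sub (h2.comp ξ (contDiffAt_const.mul hn))

/-- The symbol of the Littlewood-Paley projection. -/
def lpSymbol (χ : ℝ → ℝ) (k : ℤ) (ξ : Space d) : ℂ :=
  ((annulus χ ((2 : ℝ) ^ (-k) • ξ) : ℝ) : ℂ)

theorem IsCutoff.contDiff_lpSymbol (hχ : IsCutoff χ) (k : ℤ) :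
    ContDiff ℝ ∞ (lpSymbol χ k : Space d → ℂ) :=
  Complex.ofRealCLM.contDiff.comp (hχ.contDiff_annulus.comp (contDiff_const_smul _))

theorem IsCutoff.norm_of_lpSymbol_ne_zero (hχ : IsCutoff χ) {k : ℤ} {ξ : Space d}
    (h : lpSymbol χ k ξ ≠ 0) : 1 / 2 * (2 : ℝ) ^ k ≤ ‖ξ‖ ∧ ‖ξ‖ ≤ 2 * (2 : ℝ) ^ k := by
  have h1 : annulus χ ((2 : ℝ) ^ (-k) • ξ) ≠ 0 := fun h' => h (by rw [lpSymbol, h', Complex.ofReal_zero])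
  have h2 := mt hχ.annulus_eq_zero h1
  have h3 : (0 : ℝ) < 2 ^ k := by positivity
  rw [norm_smul, zpow_neg, norm_of_nonneg (by positivity), inv_mul_eq_div, not_or, not_le, not_le,
    lt_div_iff₀ h3, div_lt_iff₀ h3] at h2
  exact ⟨h2.1.le, h2.2.le⟩

theorem IsCutoff.hasCompactSupport_lpSymbol (hχ : IsCutoff χ) (k : ℤ) :
    HasCompactSupport (lpSymbol χ k : Space d → ℂ) := by
  refine HasCompactSupport.intro (isCompact_closedBall (0 : Space d) (2 * (2 : ℝ) ^ k)) fun ξ h => ?_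
  by_contra h'
  exact h (by simpa using (hχ.norm_of_lpSymbol_ne_zero h').2)

theorem lpProj_eq (χ : ℝ → ℝ) (k : ℤ) (g : Space d → ℂ) :
    lpProj χ k g = 𝓕⁻ (fun ξ => lpSymbol χ k ξ * 𝓕 g ξ) := rfl

/-- The product of the Littlewood-Paley symbol and the Fourier transform of a Schwartz function. -/
def IsCutoff.localized (hχ : IsCutoff χ) (k : ℤ) (g : SchwartzMap (Space d) ℂ) :
    SchwartzMap (Space d) ℂ :=
  ((hχ.hasCompactSupport_lpSymbol k).mul_right (f' := (𝓕 g : SchwartzMap (Space d) ℂ))).toSchwartzMap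
    ((hχ.contDiff_lpSymbol k).mul (𝓕 g : SchwartzMap (Space d) ℂ).smooth')

theorem IsCutoff.lpProj_eq_coe (hχ : IsCutoff χ) (k : ℤ) (g : SchwartzMap (Space d) ℂ) :
    lpProj χ k g = (𝓕⁻ (hχ.localized k g) : SchwartzMap (Space d) ℂ) := by
  rw [lpProj_eq, SchwartzMap.fourierInv_coe]
  congr 1

theorem IsCutoff.fourier_lpProj (hχ : IsCutoff χ) (k : ℤ) (g : SchwartzMap (Space d) ℂ) :
    𝓕 (lpProj χ k g) = fun ξ => lpSymbol χ k ξ * 𝓕 (g : Space d → ℂ) ξ := by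
  rw [hχ.lpProj_eq_coe, ← SchwartzMap.fourier_coe, FourierTransform.fourier_fourierInv_eq]
  rfl

theorem IsCutoff.integrable_lpProj (hχ : IsCutoff χ) (k : ℤ) (g : SchwartzMap (Space d) ℂ) :
    Integrable (lpProj χ k g) := by
  rw [hχ.lpProj_eq_coe]
  exact SchwartzMap.integrable _

theorem IsCutoff.integrable_fourier_lpProj (hχ : IsCutoff χ) (k : ℤ)
    (g : SchwartzMap (Space d) ℂ) : Integrable (𝓕 (lpProj χ k g)) := by
  rw [hχ.fourier_lpProj]
  exact (hχ.localized k g).integrable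

theorem IsCutoff.support_fourier_lpProj (hχ : IsCutoff χ) (k : ℤ) (g : SchwartzMap (Space d) ℂ)
    (hg : tsupport (𝓕 (g : Space d → ℂ)) ⊆ cone d) (ξ : Space d) (h : 𝓕 (lpProj χ k g) ξ ≠ 0) :
    2 / 5 * (2 : ℝ) ^ k ≤ ξ 0 ∧ ξ 0 ≤ 2 * 2 ^ k ∧ ‖ξ‖ ≤ 2 * 2 ^ k := by
  rw [hχ.fourier_lpProj] at h
  obtain ⟨h1, h2⟩ := hχ.norm_of_lpSymbol_ne_zero (left_ne_zero_of_mul h)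
  have h3 : ‖transversal ξ‖ ≤ ξ 0 / 10 := hg (subset_tsupport _ (right_ne_zero_of_mul h))
  have h4 : ‖ξ‖ ^ 2 = ξ 0 ^ 2 + ‖transversal ξ‖ ^ 2 := by
    rw [← norm_point_sq, point_transversal]
  have h5 := norm_nonneg (transversal ξ)
  have h6 : (0 : ℝ) < 2 ^ k := by positivity
  have h7 : 0 ≤ ξ 0 := by linarith
  have h8 : ‖transversal ξ‖ ^ 2 ≤ (ξ 0 / 10) ^ 2 := by gcongr
  refine ⟨?_, ?_, h2⟩
  -- In the cone |ξ|² ≤ 1.01 ξ₁², and 1.01 · (2/5)² < (1/2)².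
  · by_contra! h9
    have : (1 / 2 * (2 : ℝ) ^ k) ^ 2 ≤ ‖ξ‖ ^ 2 := by gcongr
    have : ξ 0 ^ 2 ≤ (2 / 5 * (2 : ℝ) ^ k) ^ 2 := by gcongr
    nlinarith
  · exact ((pow_le_pow_iff_left₀ h7 (norm_nonneg ξ) two_ne_zero).1 (by nlinarith)).trans h2

theorem hasTemperateGrowth_prodMk (t : ℝ) :
    (fun x : Space d => (t, x)).HasTemperateGrowth := by
  have h : (fun x : Space d => (t, x)) =
      fun x => (t, (0 : Space d)) + ContinuousLinearMap.inr ℝ ℝ (Space d) x := by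
    ext x <;> simp
  rw [h]
  fun_prop

/-- The function `F(t, ·)`. -/
def timeSlice (F : SchwartzMap (ℝ × Space d) ℂ) (t : ℝ) : SchwartzMap (Space d) ℂ :=
  SchwartzMap.compCLMOfAntilipschitz ℂ (g := fun x : Space d => (t, x)) (K := 1)
    (hasTemperateGrowth_prodMk t) (AntilipschitzWith.of_le_mul_dist fun x y => by
      simp [Prod.dist_eq]) F

theorem timeSlice_coe (F : SchwartzMap (ℝ × Space d) ℂ) (t : ℝ) :
    (timeSlice F t : Space d → ℂ) = fun x => F (t, x) := rfl

/-- The convolution kernel of the Littlewood-Paley projection. -/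
def IsCutoff.lpKernel (hχ : IsCutoff χ) (k : ℤ) : SchwartzMap (Space d) ℂ :=
  𝓕⁻ ((hχ.hasCompactSupport_lpSymbol k).toSchwartzMap (hχ.contDiff_lpSymbol k))

theorem IsCutoff.lpKernel_coe (hχ : IsCutoff χ) (k : ℤ) :
    (hχ.lpKernel k : Space d → ℂ) = 𝓕⁻ (lpSymbol χ k) := by
  rw [lpKernel, SchwartzMap.fourierInv_coe]
  rfl

/-- Serves to bound the L¹ norm of each time slice of F_k by that of F, and so to get joint
integrability. The factor depends on χ and k, but only its finiteness is used. -/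
theorem IsCutoff.lpProj_eq_convolution (hχ : IsCutoff χ) (k : ℤ) {g : Space d → ℂ}
    (hg : Integrable g) (x : Space d) :
    lpProj χ k g x = ∫ y, hχ.lpKernel k (x - y) * g y := by
  rw [hχ.lpKernel_coe]
  have hφ : Integrable (lpSymbol χ k : Space d → ℂ) :=
    (hχ.contDiff_lpSymbol k).continuous.integrable_of_hasCompactSupport
      (hχ.hasCompactSupport_lpSymbol k)
  rw [lpProj_eq, Real.fourierInv_eq]
  have h1 : ∀ ξ, 𝐞 (inner ℝ ξ x) • (lpSymbol χ k ξ * 𝓕 g ξ) =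
      ∫ y, 𝐞 (inner ℝ ξ (x - y)) • (lpSymbol χ k ξ * g y) := fun ξ => by
    rw [Real.fourier_eq]
    simp_rw [Circle.smul_def, smul_eq_mul, ← integral_const_mul]
    congr 1 with y
    rw [inner_sub_right, sub_eq_add_neg, AddChar.map_add_eq_mul, Circle.coe_mul,
      real_inner_comm ξ y]
    ring
  simp_rw [h1]
  rw [integral_integral_swap]
  · congr 1 with y
    rw [Real.fourierInv_eq, ← integral_mul_const]
    simp_rw [Circle.smul_def, smul_eq_mul, mul_assoc]
  · exact integrable_char_smul (hφ.mul_prod hg)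
      (θ := fun p : Space d × Space d => inner ℝ p.1 (x - p.2)) (by fun_prop)

theorem IsCutoff.lintegral_lpProj_le (hχ : IsCutoff χ) (k : ℤ) {g : Space d → ℂ}
    (hg : Integrable g) (hgm : Measurable g) :
    ∫⁻ x, ‖lpProj χ k g x‖ₑ ≤
      (∫⁻ z : Space d, ‖hχ.lpKernel k z‖ₑ) * ∫⁻ y, ‖g y‖ₑ := by
  calc ∫⁻ x, ‖lpProj χ k g x‖ₑ
      ≤ ∫⁻ x, ∫⁻ y, ‖hχ.lpKernel k (x - y)‖ₑ * ‖g y‖ₑ := by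
        refine lintegral_mono fun x => ?_
        rw [hχ.lpProj_eq_convolution k hg]
        refine (enorm_integral_le_lintegral_enorm _).trans_eq (lintegral_congr fun y => ?_)
        rw [enorm_mul]
    _ = ∫⁻ y, ∫⁻ x, ‖hχ.lpKernel k (x - y)‖ₑ * ‖g y‖ₑ := by
        refine lintegral_lintegral_swap (Measurable.aemeasurable ?_)
        have := (hχ.lpKernel (d := d) k).continuous.measurable
        fun_prop
    _ = _ := by
        rw [← lintegral_const_mul _ hgm.enorm]
        refine lintegral_congr fun y => ?_
        rw [lintegral_mul_const' _ _ enorm_ne_top, lintegral_sub_right_eq_self (fun x => ‖hχ.lpKernel k x‖ₑ) y]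

theorem IsCutoff.lintegral_lpPiece_le (hχ : IsCutoff χ) (k : ℤ)
    (F : SchwartzMap (ℝ × Space d) ℂ) (s : ℝ) :
    ∫⁻ x, ‖Function.uncurry (lpPiece χ k F) (s, x)‖ₑ ≤
      (∫⁻ z : Space d, ‖hχ.lpKernel k z‖ₑ) * ∫⁻ y, ‖F (s, y)‖ₑ := by
  have h1 := (timeSlice F s).integrable (μ := volume)
  have h2 := (timeSlice F s).continuous.measurable
  rw [timeSlice_coe] at h1 h2
  simp only [Function.uncurry, lpPiece]
  exact hχ.lintegral_lpProj_le k h1 h2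

theorem IsCutoff.isLocalized_lpPiece (hχ : IsCutoff χ) (k : ℤ) (F : SchwartzMap (ℝ × Space d) ℂ)
    (hF : ∀ t : ℝ, tsupport (𝓕 (fun x : Space d => F (t, x))) ⊆ cone d) :
    IsLocalized ((2 : ℝ) ^ k) (lpPiece χ k F) := by
  have hm : StronglyMeasurable (Function.uncurry (lpPiece χ k F)) := by
    have h1 : StronglyMeasurable (fun p : ℝ × Space d => 𝓕 (fun x => F (p.1, x)) p.2) :=
      stronglyMeasurable_fourier (f := fun t x => F (t, x)) F.continuous.stronglyMeasurable
    have h2 : StronglyMeasurable (fun p : ℝ × Space d =>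
        lpSymbol χ k p.2 * 𝓕 (fun x => F (p.1, x)) p.2) :=
      ((hχ.contDiff_lpSymbol k).continuous.comp continuous_snd).stronglyMeasurable.mul h1
    exact stronglyMeasurable_fourierInv
      (f := fun t ξ => lpSymbol χ k ξ * 𝓕 (fun x => F (t, x)) ξ) h2
  refine ⟨hm, ⟨hm.aestronglyMeasurable, ?_⟩, fun s ξ h => ?_⟩
  · have hFi : Integrable F (volume.prod volume) := F.integrable
    have hκ : ∫⁻ z : Space d, ‖hχ.lpKernel k z‖ₑ < ⊤ := (hχ.lpKernel k).integrable.2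
    have hFm : Measurable F := F.continuous.measurable
    rw [hasFiniteIntegral_iff_enorm, lintegral_prod _ hm.enorm.aemeasurable]
    refine lt_of_le_of_lt (lintegral_mono fun s => hχ.lintegral_lpPiece_le k F s) ?_
    rw [lintegral_const_mul' _ _ hκ.ne]
    refine ENNReal.mul_lt_top hκ ?_
    have := hFi.2
    rw [hasFiniteIntegral_iff_enorm, lintegral_prod _ hFm.enorm.aemeasurable] at this
    exact this
  · exact hχ.support_fourier_lpProj k (timeSlice F s) (hF s) ξ h

end Projection

/-! ### Powers of two -/

section Constants

theorem two_rpow_mul_ofReal_sqrt_le (k : ℤ) :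
    (2 : ℝ≥0∞) ^ ((k : ℝ) / 2) * ENNReal.ofReal √(2 / 5 * (2 : ℝ) ^ k)⁻¹ ≤ 2 := by
  have hk : (0 : ℝ) < 2 ^ k := by positivity
  refine le_of_sq_le_sq ?_
  rw [mul_pow, ofReal_sqrt_sq (by positivity), ← ENNReal.rpow_natCast, ← ENNReal.rpow_mul]
  have e : (k : ℝ) / 2 * (2 : ℕ) = k := by push_cast; ring
  rw [e, ENNReal.rpow_intCast]
  have e2 : (2 : ℝ≥0∞) ^ k = ENNReal.ofReal ((2 : ℝ) ^ k) := by
    rw [← ENNReal.rpow_intCast, ← rpow_intCast, ← ENNReal.ofReal_rpow_of_pos two_pos,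
      ENNReal.ofReal_ofNat]
  rw [e2, ← ENNReal.ofReal_mul hk.le]
  have e3 : (2 : ℝ) ^ k * (2 / 5 * (2 : ℝ) ^ k)⁻¹ = 5 / 2 := by field_simp
  rw [e3]
  have : (2 : ℝ≥0∞) ^ 2 = ENNReal.ofReal 4 := by norm_num
  rw [this]
  exact ENNReal.ofReal_le_ofReal (by norm_num)

theorem two_rpow_mul_ofReal_inv (k : ℤ) :
    (2 : ℝ≥0∞) ^ ((k : ℝ) / 2) * ENNReal.ofReal ((2 : ℝ) ^ k)⁻¹ = 2 ^ (-(k : ℝ) / 2) := by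
  have e2 : ENNReal.ofReal ((2 : ℝ) ^ k)⁻¹ = (2 : ℝ≥0∞) ^ (-(k : ℝ)) := by
    rw [← zpow_neg, ← rpow_intCast, Int.cast_neg, ← ENNReal.ofReal_rpow_of_pos two_pos,
      ENNReal.ofReal_ofNat]
  rw [e2, ← ENNReal.rpow_add _ _ (by norm_num) (by norm_num)]
  congr 1
  ring

end Constants

end ConeSmoothing

end

open ConeSmoothing in
theorem lemma3p1 (d : ℕ) (hd : 1 ≤ d) :
    ∃ C : ℝ≥0, ∀ χ : ℝ → ℝ, IsCutoff χ → ∀ k : ℤ,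
      ∀ f : SchwartzMap (Space d) ℂ, tsupport (𝓕 (f : Space d → ℂ)) ⊆ cone d →
      ∀ F : SchwartzMap (ℝ × Space d) ℂ,
        (∀ t : ℝ, tsupport (𝓕 (fun x : Space d => F (t, x))) ⊆ cone d) →
        (∀ γ : Set ℝ, γ.OrdConnected →
          (2 : ℝ≥0∞) ^ ((k : ℝ) / 2) * mixedNorm ∞ γ (fun t => propagator t (lpProj χ k f))
            ≤ C * eLpNorm (lpProj χ k f) 2 volume) ∧
        ((2 : ℝ≥0∞) ^ ((k : ℝ) / 2) * mixedNorm ∞ Set.univ (duhamel (lpPiece χ k F))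
            ≤ C * ((2 : ℝ≥0∞) ^ (-(k : ℝ) / 2) * mixedNorm 1 Set.univ (lpPiece χ k F))) ∧
        (∀ γ : Set ℝ, γ.OrdConnected →
          (2 : ℝ≥0∞) ^ ((k : ℝ) / 2) * eLpNorm (timeIntegral γ (lpPiece χ k F)) 2 volume
            ≤ C * mixedNorm 1 γ (lpPiece χ k F)) := by
  obtain ⟨C, hC⟩ := eLpNorm_retarded_kernel_convolution_le
  -- `C` serves the retarded estimate; 2 dominates √(5/2) = 2^(k/2) (2/5 · 2^k)^(-1/2) in the other
  -- two.
  refine ⟨C + 2, fun χ hχ k f hf F hF => ?_⟩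
  have hm : (0 : ℝ) < 2 ^ k := by positivity
  have hl : (0 : ℝ) < 2 / 5 * 2 ^ k := by positivity
  have hH := hχ.isLocalized_lpPiece k F hF
  have h2 : (2 : ℝ≥0∞) ≤ ((C + 2 : ℝ≥0) : ℝ≥0∞) := by
    push_cast
    exact le_add_self
  have hC2 : (C : ℝ≥0∞) ≤ ((C + 2 : ℝ≥0) : ℝ≥0∞) := by
    push_cast
    exact le_self_add
  refine ⟨fun γ _ => ?_, ?_, fun γ hγ => ?_⟩
  · refine (mul_le_mul_right (mixedNorm_propagator_le hl (hχ.integrable_lpProj k f)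
      (hχ.integrable_fourier_lpProj k f) (fun ξ hξ => ?_) γ) _).trans ?_
    · by_contra h
      exact absurd (hχ.support_fourier_lpProj k f hf ξ h).1 (not_le.2 hξ)
    · rw [← mul_assoc]
      gcongr
      exact (two_rpow_mul_ofReal_sqrt_le k).trans h2
  · refine (mul_le_mul_right (hH.mixedNorm_duhamel_le hC hm) _).trans ?_
    rw [← two_rpow_mul_ofReal_inv]
    calc _ = (C : ℝ≥0∞) * ((2 : ℝ≥0∞) ^ ((k : ℝ) / 2) * ENNReal.ofReal ((2 : ℝ) ^ k)⁻¹ *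
          mixedNorm 1 Set.univ (lpPiece χ k F)) := by ring
      _ ≤ _ := by gcongr
  · refine (mul_le_mul_right (hH.eLpNorm_timeIntegral_le hm hγ.measurableSet) _).trans ?_
    rw [← mul_assoc]
    gcongr
    exact (two_rpow_mul_ofReal_sqrt_le k).trans h2
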